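/- Let $n\ge 1$, let $\mathbb{K}$ be a field, and put $p=\operatorname{char}(\mathbb{K})$ if this is positive and $p=\infty$ if $\operatorname{char}(\mathbb{K})=0$. Let $T_n=\operatorname{End}(\{1,\dots,n\})$ be the transformation monoid and let $pT_n\subset T_n$ be the planar transformation monoid, that is, the submonoid of order-preserving maps $\{1,\dots,n\}\to\{1,\dots,n\}$ (the maps that have a planar string diagram). Let $X_n$ be either of them, and let $\mathbb{K}X_n$ be its monoid algebra; modules are left modules. For $a,b\in X_n$ write $a\leq_{lr}b$ if $b=cad$ for some $c,d\in X_n$. The equivalence classes of this preorder are the $J$-cells of $X_n$, and they are partially ordered by $\leq_{lr}$. An apex of a $\mathbb{K}X_n$-module $M$ is a $J$-cell $\mathcal{J}$ that is maximal with respect to $\leq_{lr}$ among the $J$-cells whose $\mathbb{K}$-span in $\mathbb{K}X_n$ does not annihilate $M$. For $1\le\lambda\le n$ let $\mathcal{J}_\lambda=\{a\in X_n : |a(\{1,\dots,n\})|=\lambda\}$ be the set of elements with $\lambda$ through strands. Let $\mathrm{P}(\lambda|p)$ be the set of $p$-restricted Young diagrams with $\lambda$ boxes, that is, of Young diagrams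 with $\lambda$ boxes such that the lengths of any two consecutive columns differ by less than $p$ (empty columns have length zero; for $p=\infty$ there is no condition). Then every simple $\mathbb{K}X_n$-module has precisely one apex, and the set of apexes of simple $\mathbb{K}X_n$-modules is $\{\mathcal{J}_n<_{lr}\mathcal{J}_{n-1}<_{lr}\dots<_{lr}\mathcal{J}_1\}$. For each $1\le\lambda\le n$ there are, up to isomorphism, precisely $|\mathrm{P}(\lambda|p)|$ simple $\mathbb{K}T_n$-modules with apex $\mathcal{J}_\lambda$, and precisely one simple $\mathbb{K}pT_n$-module with apex $\mathcal{J}_\lambda$. -/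

import Mathlib

universe u v w

/-- The two-sided (Green) preorder on a monoid: `a ≤ b` iff `b = c * a * d` for some `c`, `d`.
Larger elements are those that generate smaller two-sided ideals. -/
def TwoSidedLE {X : Type v} [Monoid X] (a b : X) : Prop :=
  ∃ c d : X, b = c * a * d

/-- A `J`-cell of a monoid: an equivalence class of the two-sided preorder. -/
def IsJCell {X : Type v} [Monoid X] (J : Set X) : Prop :=
  ∃ a : X, J = {b : X | TwoSidedLE a b ∧ TwoSidedLE b a}

/-- The order on `J`-cells induced by the two-sided preorder. -/
def JCellLE {X : Type v} [Monoid X] (J J' : Set X) : Prop :=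
  ∃ a ∈ J, ∃ b ∈ J', TwoSidedLE a b

/-- The `K`-span of `J ⊆ X` in the monoid algebra `K[X]` annihilates the left module `M`. -/
def SpanAnnihilates (K : Type u) [Field K] {X : Type v} [Monoid X] (J : Set X)
    (M : Type w) [AddCommGroup M] [Module (MonoidAlgebra K X) M] : Prop :=
  ∀ x ∈ Submodule.span K (MonoidAlgebra.of K X '' J), ∀ m : M, x • m = 0

/-- `J` is an apex of the left `K[X]`-module `M`: it is maximal among the `J`-cells of `X` whose
`K`-span does not annihilate `M`. -/
def IsApex (K : Type u) [Field K] {X : Type v} [Monoid X]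
    (M : Type w) [AddCommGroup M] [Module (MonoidAlgebra K X) M] (J : Set X) : Prop :=
  IsJCell J ∧ ¬ SpanAnnihilates K J M ∧
    ∀ J' : Set X, IsJCell J' → ¬ SpanAnnihilates K J' M → JCellLE J J' → J' = J

/-- The simple left `K[X]`-modules having `J` as an apex. -/
def SimpleWithApex (K : Type u) [Field K] {X : Type} [Monoid X] (J : Set X) : Type (u + 1) :=
  {M : ModuleCat.{u} (MonoidAlgebra K X) // IsSimpleModule (MonoidAlgebra K X) M ∧ IsApex K M J}

/-- Isomorphism of modules, as an equivalence relation on the simple modules with apex `J`. -/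
def simpleWithApexSetoid (K : Type u) [Field K] {X : Type} [Monoid X] (J : Set X) :
    Setoid (SimpleWithApex K J) where
  r M N := Nonempty (M.1 ≃ₗ[MonoidAlgebra K X] N.1)
  iseqv :=
    { refl := fun M => ⟨LinearEquiv.refl _ M.1⟩
      symm := fun ⟨e⟩ => ⟨e.symm⟩
      trans := fun ⟨e⟩ ⟨f⟩ => ⟨e.trans f⟩ }

/-- The isomorphism classes of simple left `K[X]`-modules with apex `J`. -/
def SimpleClassesWithApex (K : Type u) [Field K] {X : Type} [Monoid X] (J : Set X) :
    Type (u + 1) :=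
  Quotient (simpleWithApexSetoid K J)

/-- The transformation monoid: all self-maps of an `n`-element set; `a * b` is `a ∘ b`. -/
abbrev TransformationMonoid (n : ℕ) : Type := Function.End (Fin n)

/-- The planar transformation monoid. A map has a planar string diagram (strands may merge but not
cross) exactly if it is order-preserving. -/
def PlanarTransformationMonoid (n : ℕ) : Submonoid (TransformationMonoid n) where
  carrier := {a | ∀ i j : Fin n, i ≤ j → a i ≤ a j}
  one_mem' := fun _ _ h => h
  mul_mem' := fun {_ _} ha hb _ _ h => ha _ _ (hb _ _ h)

/-- The number of through strands of a transformation, that is, the size of its image. -/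
def throughStrands {n : ℕ} (a : TransformationMonoid n) : ℕ :=
  (Finset.univ.image fun i : Fin n => a i).card

/-- The transformations with `l` through strands. -/
def transformationCell (n l : ℕ) : Set (TransformationMonoid n) :=
  {a | throughStrands a = l}

/-- The planar transformations with `l` through strands. -/
def planarCell (n l : ℕ) : Set (PlanarTransformationMonoid n) :=
  {a | throughStrands (a : TransformationMonoid n) = l}

/-- The characteristic of `K`, where characteristic zero counts as `∞`. -/
noncomputable def extendedChar (K : Type u) [Field K] : ℕ∞ :=
  if ringChar K = 0 then ⊤ else (ringChar K : ℕ∞)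

/-- The `p`-restricted Young diagrams with `l` boxes: the lengths of any two consecutive columns
(empty columns have length zero) differ by less than `p`. Column lengths decrease weakly, so the
subtraction in `ℕ` does not truncate. -/
def RestrictedDiagram (l : ℕ) (p : ℕ∞) : Type :=
  {μ : YoungDiagram // μ.card = l ∧
    ∀ j : ℕ, ((μ.colLen j - μ.colLen (j + 1) : ℕ) : ℕ∞) < p}

/-! The number of through strands determines the two-sided preorder, in reverse: `b` lies in the
ideal generated by `a` iff its rank is at most that of `a`. So the `J`-cells form a chain, and the
apex of a simple module is the cell of the least rank that acts nontrivially. The cell of rank `l`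
contains the idempotent `e = truncation n l`, and `e X e` consists of a group `G` together with
elements of smaller rank. The group is the symmetric group on `l` letters for all transformations,
and trivial for the planar ones, since an order-preserving permutation is the identity.

Simple modules with this apex are counted by two bounds that meet. From below, as in
Clifford–Munn–Ponizovskii theory, each maximal left ideal of the group algebra yields one of the
monoid algebra, and isomorphic quotients above force isomorphic quotients below
(`GroupCorner.isMaximal_coind`, `GroupCorner.nonempty_equiv_of_coind`). From above, Brauer's
character argument is run on the monoid itself: traces on `G` are linearly independent and depend
only on the conjugacy class of the `p`-regular part (`card_le_of_simple_of_groupCorner`).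

For the symmetric group the lower bound comes from James's construction. A polytabloid generates a
Specht module; a column antisymmetrizer, composed with a row reversal, multiplies it by a scalar
that is nonzero for restricted shapes (`exists_antisymmetrizer_eigen`,
`rowLenStabilizer_card_ne_zero`). Hence the antisymmetrizer survives in a simple quotient, and
dominance recovers the shape. Glaisher's theorem equates the restricted diagrams with the
`p`-regular classes. -/

/-! ### Simple modules over finite-dimensional algebras -/

section SimpleModules

open scoped TensorProduct

/-- Jacobson density on a finite `K`-spanning set; agreement there spreads to all of `M` because the
action is `K`-linear. -/
theorem exists_smul_eq_of_commutes {K A M : Type*} [Field K] [Ring A] [Algebra K A]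
    [AddCommGroup M] [Module K M] [Module A M] [IsScalarTower K A M] [IsSemisimpleModule A M]
    [Module.Finite K M] (T : M →ₗ[K] M)
    (hT : ∀ (φ : Module.End A M) (m : M), T (φ m) = φ (T m)) : ∃ a : A, ∀ m : M, a • m = T m := by
  obtain ⟨s, hs⟩ := Module.Finite.fg_top (R := K) (M := M)
  let T' : Module.End (Module.End A M) M :=
    { toFun := T, map_add' := T.map_add, map_smul' := fun φ m => hT φ m }
  obtain ⟨a, ha⟩ := jacobson_density T' s
  refine ⟨a, fun m => ?_⟩
  have hm : m ∈ Submodule.span K (s : Set M) := hs ▸ Submodule.mem_top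
  induction hm using Submodule.span_induction with
  | mem m hm => exact (ha m hm).symm
  | zero => simp
  | add x y _ _ hx hy => rw [smul_add, hx, hy, map_add]
  | smul c x _ hx =>
    rw [map_smul, ← hx, ← algebraMap_smul A c x, ← algebraMap_smul A c (a • x), ← mul_smul,
      ← mul_smul, Algebra.commutes]

theorem finite_of_isSimpleModule (K : Type*) {A M : Type*} [Field K] [Ring A] [Algebra K A]
    [Module.Finite K A] [AddCommGroup M] [Module K M] [Module A M] [IsScalarTower K A M]
    [IsSimpleModule A M] : Module.Finite K M :=
  Module.Finite.trans A M

/-- **Burnside's theorem** over an algebraically closed field. -/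
theorem exists_smul_eq_of_isAlgClosed {L B N : Type*} [Field L] [IsAlgClosed L] [Ring B]
    [Algebra L B] [AddCommGroup N] [Module L N] [Module B N] [IsScalarTower L B N]
    [IsSimpleModule B N] [Module.Finite L N] (T : Module.End L N) :
    ∃ b : B, ∀ n : N, b • n = T n := by
  refine exists_smul_eq_of_commutes T fun φ m => ?_
  obtain ⟨c, rfl⟩ :=
    (IsSimpleModule.algebraMap_end_bijective_of_isAlgClosed (A := B) (V := N) L).2 φ
  simp

/-- There are no nonzero maps between `M` and `N`, so the projection of the semisimple module `M ×
N` onto `M` commutes with all its endomorphisms and is the action of an algebra element. -/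
theorem exists_separating_of_simple (K : Type*) {A M N : Type*} [Field K] [Ring A] [Algebra K A]
    [Module.Finite K A] [AddCommGroup M] [Module K M] [Module A M] [IsScalarTower K A M]
    [AddCommGroup N] [Module K N] [Module A N] [IsScalarTower K A N]
    [IsSimpleModule A M] [IsSimpleModule A N] (h : IsEmpty (M ≃ₗ[A] N)) :
    ∃ a : A, (∀ m : M, a • m = m) ∧ ∀ n : N, a • n = 0 := by
  have : IsSemisimpleModule A (M × N) := by
    have h1 := IsSemisimpleModule.range (LinearMap.inl A M N)
    have h2 := IsSemisimpleModule.range (LinearMap.inr A M N)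
    have h3 := IsSemisimpleModule.sup h1 h2
    rw [LinearMap.sup_range_inl_inr] at h3
    exact IsSemisimpleModule.congr Submodule.topEquiv.symm
  have := finite_of_isSimpleModule K (A := A) (M := M)
  have := finite_of_isSimpleModule K (A := A) (M := N)
  have hMN (f : M →ₗ[A] N) : f = 0 := f.bijective_or_eq_zero.resolve_left fun hf =>
    h.false (LinearEquiv.ofBijective f hf)
  have hNM (f : N →ₗ[A] M) : f = 0 := f.bijective_or_eq_zero.resolve_left fun hf =>
    h.false (LinearEquiv.ofBijective f hf).symm
  obtain ⟨a, ha⟩ := exists_smul_eq_of_commutes (K := K) (A := A) (M := M × N)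
    (LinearMap.inl K M N ∘ₗ LinearMap.fst K M N) fun φ m => by
      have h1 := LinearMap.congr_fun (hNM (LinearMap.fst A M N ∘ₗ φ ∘ₗ LinearMap.inr A M N)) m.2
      have h2 := LinearMap.congr_fun (hMN (LinearMap.snd A M N ∘ₗ φ ∘ₗ LinearMap.inl A M N)) m.1
      have h3 : φ m = φ (m.1, 0) + φ (0, m.2) := by rw [← map_add]; simp
      simp at h1 h2
      ext <;> simp [h3, h1, h2]
  refine ⟨a, fun m => ?_, fun n => ?_⟩
  · simpa using congrArg Prod.fst (ha (m, 0))
  · simpa using congrArg Prod.snd (ha (0, n))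

theorem exists_simple_quotient (L : Type*) (B : Type*) (W : Type v) [Field L] [Ring B]
    [Algebra L B] [AddCommGroup W] [Module L W] [Module B W] [IsScalarTower L B W] [Nontrivial W]
    [Module.Finite L W] :
    ∃ (N : Type v) (_ : AddCommGroup N) (_ : Module L N) (_ : Module B N)
      (_ : IsScalarTower L B N) (_ : IsSimpleModule B N) (π : W →ₗ[B] N),
      Function.Surjective π := by
  have : Module.Finite B W := Module.Finite.of_restrictScalars_finite L _ _
  obtain ⟨Q, hQ, -⟩ := (eq_top_or_exists_le_coatom (⊥ : Submodule B W)).resolve_left bot_ne_top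
  exact ⟨W ⧸ Q, inferInstance, inferInstance, inferInstance, inferInstance,
    isSimpleModule_iff_isCoatom.2 hQ, Q.mkQ, Q.mkQ_surjective⟩

/-- A simple module over a finite-dimensional algebra gives, over an algebraically closed extension
field, an irreducible representation with the same annihilator. -/
theorem exists_absolutely_irreducible (K L : Type u) {A M : Type u} [Field K] [Field L]
    [Algebra K L] [IsAlgClosed L] [Ring A] [Algebra K A] [Module.Finite K A] [AddCommGroup M]
    [Module K M] [Module A M] [IsScalarTower K A M] [IsSimpleModule A M] :
    ∃ (N : Type u) (_ : AddCommGroup N) (_ : Module L N) (_ : Module.Finite L N)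
      (ψ : A →+* Module.End L N),
      (∀ (c : K) (a : A), ψ (c • a) = algebraMap K L c • ψ a) ∧
      Submodule.span L (Set.range ψ) = ⊤ ∧ ∀ a : A, ψ a = 0 ↔ ∀ m : M, a • m = 0 := by
  have := finite_of_isSimpleModule K (A := A) (M := M)
  have := IsSimpleModule.nontrivial A M
  let Φ : L ⊗[K] A →ₐ[L] Module.End L (L ⊗[K] M) :=
    Algebra.TensorProduct.lift (Algebra.ofId L _)
      ((Module.End.baseChangeHom K L M).comp (Algebra.lsmul K K M))
      fun c a => Algebra.commutes c _
  let _ : Module (L ⊗[K] A) (L ⊗[K] M) := Module.compHom _ Φ.toRingHom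
  have smul_def (b : L ⊗[K] A) (w : L ⊗[K] M) : b • w = Φ b w := rfl
  have tmul_smul (a : A) (l : L) (m : M) : ((1 : L) ⊗ₜ[K] a) • (l ⊗ₜ[K] m) = l ⊗ₜ (a • m) := by
    have : Φ ((1 : L) ⊗ₜ[K] a) = LinearMap.baseChange L (Algebra.lsmul K K M a) := by
      refine (Algebra.TensorProduct.lift_tmul _ _ _ _ _).trans ?_
      rw [map_one, one_mul]; rfl
    rw [smul_def, this]; rfl
  have : IsScalarTower L (L ⊗[K] A) (L ⊗[K] M) := ⟨fun c b w => by simp [smul_def]⟩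
  have : Module.Finite (L ⊗[K] A) (L ⊗[K] M) := Module.Finite.of_restrictScalars_finite L _ _
  obtain ⟨N, _, _, _, _, _, π, hπ⟩ := exists_simple_quotient L (L ⊗[K] A) (L ⊗[K] M)
  have := finite_of_isSimpleModule L (A := L ⊗[K] A) (M := N)
  let ψ : A →+* Module.End L N :=
    (Algebra.lsmul L L N : L ⊗[K] A →ₐ[L] Module.End L N).toRingHom.comp
      (Algebra.TensorProduct.includeRight : A →ₐ[K] L ⊗[K] A).toRingHom
  have ψ_apply (a : A) (n : N) : ψ a n = ((1 : L) ⊗ₜ[K] a) • n := rfl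
  refine ⟨N, inferInstance, inferInstance, inferInstance, ψ, fun c a => ?_, ?_, fun a => ⟨?_, ?_⟩⟩
  · ext n
    rw [LinearMap.smul_apply, ψ_apply, ψ_apply, ← smul_assoc, TensorProduct.tmul_smul,
      algebraMap_smul]
  · refine eq_top_iff.2 fun T _ => ?_
    obtain ⟨b, hb⟩ := exists_smul_eq_of_isAlgClosed (B := L ⊗[K] A) T
    obtain rfl : Algebra.lsmul L L N b = T := LinearMap.ext hb
    clear hb
    induction b using TensorProduct.induction_on with
    | zero => simp
    | add x y hx hy => rw [map_add]; exact add_mem (hx trivial) (hy trivial)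
    | tmul l a =>
      have : l ⊗ₜ[K] a = l • ((1 : L) ⊗ₜ[K] a) := by simp [TensorProduct.smul_tmul']
      rw [this, map_smul]
      exact Submodule.smul_mem _ _ (Submodule.subset_span ⟨a, rfl⟩)
  · intro ha m
    by_contra hm
    -- Passing to the quotient `N` loses nothing of the annihilator: the vectors of `M` that die in
    -- `N` form a submodule. If it were all of `M`, then `π` would vanish, as `1 ⊗ M` spans over
    -- `L`.
    let ker : Submodule A M :=
      { carrier := {m | π ((1 : L) ⊗ₜ[K] m) = 0}
        zero_mem' := by simp
        add_mem' := fun {x y} hx hy => by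
          simp only [Set.mem_ofPred_eq] at *
          rw [TensorProduct.tmul_add, map_add, hx, hy, add_zero]
        smul_mem' := fun c x hx => by
          simp only [Set.mem_ofPred_eq] at *
          rw [← tmul_smul, map_smul, hx, smul_zero] }
    have hker : ker = ⊤ := (eq_bot_or_eq_top ker).resolve_left fun h => hm <| by
      have : a • m ∈ ker := by
        change π _ = 0
        rw [← tmul_smul, map_smul]
        exact LinearMap.congr_fun ha _
      rwa [h] at this
    obtain ⟨n, hn⟩ := @exists_ne N (IsSimpleModule.nontrivial (L ⊗[K] A) N) 0
    obtain ⟨w, rfl⟩ := hπ n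
    refine hn ?_
    clear hn
    induction w using TensorProduct.induction_on with
    | zero => simp
    | add x y hx hy => rw [map_add, hx, hy, add_zero]
    | tmul l m =>
      have h1 : m ∈ ker := hker ▸ trivial
      have h2 : l ⊗ₜ[K] m = l • ((1 : L) ⊗ₜ[K] m) := by simp [TensorProduct.smul_tmul']
      have h3 : π (l • ((1 : L) ⊗ₜ[K] m)) = l • π ((1 : L) ⊗ₜ[K] m) :=
        (π.restrictScalars L).map_smul l _
      rw [h2, h3, show π ((1 : L) ⊗ₜ[K] m) = 0 from h1, smul_zero]
  · intro ha
    ext n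
    obtain ⟨w, rfl⟩ := hπ n
    rw [ψ_apply, ← map_smul]
    suffices ((1 : L) ⊗ₜ[K] a) • w = 0 by rw [this]; simp
    induction w using TensorProduct.induction_on with
    | zero => simp
    | add x y hx hy => rw [smul_add, hx, hy, add_zero]
    | tmul l m => rw [tmul_smul, ha, TensorProduct.tmul_zero]

end SimpleModules

/-! ### Groups in a corner of a monoid, and Brauer's bound -/

/-- A group `G` inside a monoid `X`, together with an ideal `I` of `X` disjoint from `G`, such that
the corner of `X` at the identity `e` of `G` consists of elements of `G` and of `I`. -/
structure GroupCorner (X : Type v) [Monoid X] (G : Type w) [Group G] (I : Set X) where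
  /-- The inclusion of the group. -/
  toFun : G → X
  toFun_mul : ∀ g h, toFun (g * h) = toFun g * toFun h
  injective : Function.Injective toFun
  notMem : ∀ g, toFun g ∉ I
  mul_mem_left : ∀ x, ∀ y ∈ I, x * y ∈ I
  mul_mem_right : ∀ x, ∀ y ∈ I, y * x ∈ I
  corner : ∀ x, toFun 1 * x * toFun 1 ∈ I ∨ ∃ g, toFun 1 * x * toFun 1 = toFun g

namespace GroupCorner

variable {X : Type v} [Monoid X] {G : Type w} [Group G] {I : Set X}

/-- Exponent zero is excluded because `toFun 1` is an idempotent that need not be `1`. -/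
theorem toFun_pow (C : GroupCorner X G I) (g : G) {k : ℕ} (hk : k ≠ 0) :
    C.toFun (g ^ k) = C.toFun g ^ k := by
  obtain ⟨k, rfl⟩ := Nat.exists_eq_succ_of_ne_zero hk
  induction k with
  | zero => simp
  | succ k ih => rw [pow_succ, C.toFun_mul, ih (by simp), pow_succ _ (k + 1)]

end GroupCorner

open scoped Classical in
theorem exists_smul_eq_self_and_annihilates {A : Type*} [Ring A] {J : Type*} [Fintype J]
    (M : J → Type*) [∀ j, AddCommGroup (M j)] [∀ j, Module A (M j)] (i : J)
    (h : ∀ j, j ≠ i → ∃ a : A, (∀ m : M i, a • m = m) ∧ ∀ m : M j, a • m = 0) :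
    ∃ a : A, (∀ m : M i, a • m = m) ∧ ∀ j, j ≠ i → ∀ m : M j, a • m = 0 := by
  classical
  suffices ∀ s : Finset J, i ∉ s →
      ∃ a : A, (∀ m : M i, a • m = m) ∧ ∀ j ∈ s, ∀ m : M j, a • m = 0 by
    obtain ⟨a, h1, h2⟩ := this (Finset.univ.erase i) (by simp)
    exact ⟨a, h1, fun j hj => h2 j (by simp [hj])⟩
  intro s
  induction s using Finset.induction_on with
  | empty => exact fun _ => ⟨1, by simp, by simp⟩
  | insert k s hk ih =>
    intro his
    rw [Finset.mem_insert, not_or] at his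
    obtain ⟨a, h1, h2⟩ := ih his.2
    obtain ⟨b, h3, h4⟩ := h k (Ne.symm his.1)
    refine ⟨a * b, fun m => by rw [mul_smul, h3, h1], fun j hj m => ?_⟩
    rcases Finset.mem_insert.1 hj with rfl | hj
    · rw [mul_smul, h4, smul_zero]
    · rw [mul_smul, h2 j hj]

/-- By the Frobenius identity for commuting endomorphisms, `S - T` is nilpotent, so it has trace
zero. -/
theorem trace_eq_of_pow_eq {L N : Type*} [Field L] [AddCommGroup N] [Module L N]
    {p : ℕ} [Fact p.Prime] [CharP L p] (S T : Module.End L N) (h : Commute S T)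
    {k : ℕ} (hk : S ^ p ^ k = T ^ p ^ k) : LinearMap.trace L N S = LinearMap.trace L N T := by
  rw [← sub_eq_zero, ← map_sub]
  have : CharP (Module.End L N) p ∨ Subsingleton N := by
    rcases subsingleton_or_nontrivial N with h | h
    · exact Or.inr h
    · exact Or.inl (charP_of_injective_algebraMap (algebraMap L _).injective p)
  rcases this with _ | _
  · have : IsNilpotent (S - T) := ⟨p ^ k, by rw [sub_pow_char_pow_of_commute _ _ h, hk, sub_self]⟩
    exact (LinearMap.isNilpotent_trace_of_isNilpotent this).eq_zero
  · rw [Subsingleton.elim (S - T) 0, map_zero]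

/-- Elements of a group that have the same trace in all representations over fields of
characteristic `p`, since some power of `p` makes them equal, up to conjugation. -/
def TraceEquivalent {G : Type w} [Group G] (p : ℕ) (g h : G) : Prop :=
  ∃ s : G, IsConj s h ∧ Commute g s ∧ (g = s ∨ p.Prime ∧ ∃ k, g ^ p ^ k = s ^ p ^ k)

/-- **Brauer's upper bound** for the number of simple modules with given apex. -/
theorem card_le_of_simple_of_groupCorner (K : Type u) [Field K] {X : Type} [Monoid X] [Finite X]
    {G : Type w} [Group G] {I : Set X} (C : GroupCorner X G I) {R : Type*} [Fintype R] (s : R → G)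
    (hs : ∀ g, ∃ r, TraceEquivalent (ringChar K) g (s r)) {J : Type*} [Fintype J]
    (M : J → Type u) [∀ j, AddCommGroup (M j)] [∀ j, Module (MonoidAlgebra K X) (M j)]
    [∀ j, IsSimpleModule (MonoidAlgebra K X) (M j)]
    (hM : ∀ i j, i ≠ j → IsEmpty (M i ≃ₗ[MonoidAlgebra K X] M j))
    (hI : ∀ j, ∀ x ∈ I, ∀ m : M j, MonoidAlgebra.of K X x • m = 0)
    (hC : ∀ j, ∃ m : M j, MonoidAlgebra.of K X (C.toFun 1) • m ≠ 0) :
    Fintype.card J ≤ Fintype.card R := by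
  let _ (j : J) : Module K (M j) := Module.compHom (M j) (algebraMap K (MonoidAlgebra K X))
  have (j : J) : IsScalarTower K (MonoidAlgebra K X) (M j) :=
    ⟨fun c a m => by rw [Algebra.smul_def, mul_smul]; rfl⟩
  let L := AlgebraicClosure K
  have hN (j : J) := exists_absolutely_irreducible K L (A := MonoidAlgebra K X) (M := M j)
  choose N _ _ _ ψ hψK hψ hψM using hN
  have hsep (i : J) := exists_smul_eq_self_and_annihilates (A := MonoidAlgebra K X) M i fun j hj =>
    exists_separating_of_simple K (hM i j hj.symm)
  choose d hd1 hd2 using hsep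
  let ρ (j : J) (x : X) : Module.End L (N j) := ψ j (MonoidAlgebra.of K X x)
  have ρ_mul (j : J) (x y : X) : ρ j (x * y) = ρ j x * ρ j y := by simp [ρ, ← map_mul]
  have ρ_pow (j : J) (x : X) (k : ℕ) : ρ j (x ^ k) = ρ j x ^ k := by
    simp only [ρ, map_pow]
  have trace_conj (j : J) (g h : G) (hgh : IsConj g h) :
      LinearMap.trace L _ (ρ j (C.toFun g)) = LinearMap.trace L _ (ρ j (C.toFun h)) := by
    obtain ⟨c, rfl⟩ := isConj_iff.1 hgh
    rw [C.toFun_mul, ρ_mul, LinearMap.trace_mul_comm, ← ρ_mul, ← C.toFun_mul]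
    congr 3; group
  have trace_eq (j : J) (g h : G) (hgh : TraceEquivalent (ringChar K) g h) :
      LinearMap.trace L _ (ρ j (C.toFun g)) = LinearMap.trace L _ (ρ j (C.toFun h)) := by
    obtain ⟨t, ht, hgt, rfl | ⟨hp, k, hk⟩⟩ := hgh
    · exact trace_conj j _ _ ht
    · rw [← trace_conj j _ _ ht]
      have := Fact.mk hp
      have : CharP L (ringChar K) := charP_of_injective_algebraMap (algebraMap K L).injective _
      refine trace_eq_of_pow_eq (p := ringChar K) (k := k) _ _ ?_ ?_
      · rw [Commute, SemiconjBy, ← ρ_mul, ← ρ_mul, ← C.toFun_mul, ← C.toFun_mul, hgt.eq]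
      · have : ringChar K ^ k ≠ 0 := pow_ne_zero _ hp.ne_zero
        rw [← ρ_pow, ← ρ_pow, ← C.toFun_pow _ this, ← C.toFun_pow _ this, hk]
  -- The bound follows from this: `J` indexes independent vectors in a space of dimension `card R`.
  have hli : LinearIndependent L fun j (r : R) => LinearMap.trace L _ (ρ j (C.toFun (s r))) := by
    rw [Fintype.linearIndependent_iff]
    intro c hc i
    have h1 (g : G) : ∑ j, c j * LinearMap.trace L _ (ρ j (C.toFun g)) = 0 := by
      obtain ⟨r, hr⟩ := hs g
      simp_rw [fun j => trace_eq j _ _ hr]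
      simpa using congrFun hc r
    -- The relation extends from `G` to the whole algebra after compression by the idempotent,
    -- because a compressed monoid element lies in `G` or in `I`, and `I` acts as zero.
    have h2 (a : MonoidAlgebra K X) : ∑ j, c j * LinearMap.trace L _
        (ρ j (C.toFun 1) * ψ j a * ρ j (C.toFun 1)) = 0 := by
      induction a using MonoidAlgebra.induction_on with
      | of x =>
        simp_rw [show ∀ j, ψ j (MonoidAlgebra.of K X x) = ρ j x from fun _ => rfl, ← ρ_mul]
        rcases C.corner x with hx | ⟨g, hg⟩
        · refine Finset.sum_eq_zero fun j _ => ?_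
          rw [show ρ j _ = 0 from (hψM j _).2 (hI j _ hx), map_zero, mul_zero]
        · rw [hg]; exact h1 g
      | add a b ha hb =>
        simp only [map_add, mul_add, add_mul, Finset.sum_add_distrib, ha, hb, add_zero]
      | smul l a ha =>
        simp only [hψK, smul_mul_assoc, mul_smul_comm, map_smul, smul_eq_mul, mul_left_comm (c _)]
        rw [← Finset.mul_sum, ha, mul_zero]
    -- Multiplying by `d i`, which acts as the identity on `M i` and as zero on the others, isolates
    -- one summand. As `ψ i` spans all endomorphisms, `T` is arbitrary.
    have h3 (T : Module.End L (N i)) :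
        c i * LinearMap.trace L _ (ρ i (C.toFun 1) * T * ρ i (C.toFun 1)) = 0 := by
      have hT : T ∈ Submodule.span L (Set.range (ψ i)) := hψ i ▸ Submodule.mem_top
      induction hT using Submodule.span_induction with
      | mem T hT =>
        obtain ⟨a, rfl⟩ := hT
        have h := h2 (a * d i)
        rw [Finset.sum_eq_single i] at h
        · have hd : ψ i (d i) = 1 := by
            rw [← sub_eq_zero, ← map_one (ψ i), ← map_sub, hψM]
            simp [sub_smul, hd1]
          rwa [(ψ i).map_mul, hd, mul_one] at h
        · intro j _ hj
          rw [(ψ j).map_mul, (hψM j (d i)).2 (hd2 i j hj)]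
          simp
        · simp
      | zero => simp
      | add S T _ _ hS hT => rw [mul_add, add_mul, map_add, mul_add, hS, hT, add_zero]
      | smul l T _ hT =>
        rw [mul_smul_comm, smul_mul_assoc, map_smul, smul_eq_mul, mul_left_comm, hT, mul_zero]
    set E := ρ i (C.toFun 1) with hE
    have hEE : E * E = E := by rw [hE, ← ρ_mul, ← C.toFun_mul, mul_one]
    have hE0 : E ≠ 0 := by
      rw [hE, Ne, show ρ i _ = ψ i _ from rfl, hψM]
      push Not
      exact hC i
    obtain ⟨w, hw⟩ := DFunLike.ne_iff.1 hE0
    obtain ⟨f, hf⟩ := Module.Projective.exists_dual_eq_one L hw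
    -- This rank-one operator has trace `f (E w) = 1`, so the coefficient `c i` vanishes.
    have h4 : E * f.smulRight (E w) * E = (f ∘ₗ E).smulRight (E w) := by
      ext x
      simp [← Module.End.mul_apply E E w, hEE]
    have h5 := h3 (f.smulRight (E w))
    rwa [h4, LinearMap.trace_smulRight, LinearMap.comp_apply, ← Module.End.mul_apply E E w, hEE, hf,
      mul_one] at h5
  simpa using hli.fintype_card_le_finrank

/-! ### From left ideals of the group algebra to left ideals of the monoid algebra -/

namespace GroupCorner

open MonoidAlgebra (of)

variable (K : Type u) [Field K] {X : Type v} [Monoid X] {G : Type w} [Group G] {I : Set X}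
  (C : GroupCorner X G I)

/-- The identity of the group, in the monoid algebra. -/
noncomputable def idem : MonoidAlgebra K X := of K X (C.toFun 1)

/-- The inclusion of the group algebra in the monoid algebra, which does not preserve `1`. -/
noncomputable def incl : MonoidAlgebra K G →ₙₐ[K] MonoidAlgebra K X :=
  MonoidAlgebra.mapDomainNonUnitalAlgHom K K ⟨C.toFun, C.toFun_mul⟩

/-- The linear projection of the monoid algebra onto the group algebra. -/
noncomputable def proj : MonoidAlgebra K X →ₗ[K] MonoidAlgebra K G :=
  (MonoidAlgebra.coeffLinearEquiv K).symm.toLinearMap ∘ₗ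
    Finsupp.lcomapDomain C.toFun C.injective ∘ₗ (MonoidAlgebra.coeffLinearEquiv K).toLinearMap

theorem incl_of (g : G) : C.incl K (of K G g) = of K X (C.toFun g) := by
  simp [incl]

theorem incl_one : C.incl K 1 = C.idem K := C.incl_of K 1

theorem proj_of_toFun (g : G) : C.proj K (of K X (C.toFun g)) = of K G g := by
  classical
  ext h
  simp [proj, MonoidAlgebra.coeffLinearEquiv, Finsupp.single_apply]

theorem proj_of_mem {x : X} (hx : x ∈ I) : C.proj K (of K X x) = 0 := by
  classical
  ext h
  have : x ≠ C.toFun h := fun e => C.notMem h (e ▸ hx)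
  simp [proj, MonoidAlgebra.coeffLinearEquiv, this]

theorem proj_incl (y : MonoidAlgebra K G) : C.proj K (C.incl K y) = y := by
  induction y using MonoidAlgebra.induction_on with
  | of g => rw [incl_of, proj_of_toFun]
  | add x y hx hy => rw [map_add, map_add, hx, hy]
  | smul r x hx => rw [map_smul, map_smul, hx]

theorem idem_mul_incl (y : MonoidAlgebra K G) : C.idem K * C.incl K y = C.incl K y := by
  rw [← incl_one, ← map_mul, one_mul]

theorem incl_mul_idem (y : MonoidAlgebra K G) : C.incl K y * C.idem K = C.incl K y := by
  rw [← incl_one, ← map_mul, mul_one]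

theorem idem_mul_idem : C.idem K * C.idem K = C.idem K := by
  rw [← incl_one, ← map_mul, mul_one]

/-- Linearized form of `corner`: modulo the span of `I`, the corner algebra is the group algebra. -/
theorem corner_mem_span (a : MonoidAlgebra K X) :
    C.idem K * a * C.idem K - C.incl K (C.proj K (C.idem K * a * C.idem K)) ∈
      Submodule.span K (of K X '' I) := by
  induction a using MonoidAlgebra.induction_on with
  | of x =>
    rw [idem, ← map_mul, ← map_mul]
    rcases C.corner x with hx | ⟨g, hg⟩
    · rw [proj_of_mem _ _ hx, map_zero, sub_zero]
      exact Submodule.subset_span ⟨_, hx, rfl⟩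
    · rw [hg, proj_of_toFun, incl_of, sub_self]
      exact zero_mem _
  | add x y hx hy =>
    simp only [mul_add, add_mul, map_add]
    rw [add_sub_add_comm]
    exact add_mem hx hy
  | smul r x hx =>
    simp only [mul_smul_comm, smul_mul_assoc, map_smul, ← smul_sub]
    exact Submodule.smul_mem _ _ hx

theorem mul_mem_span (C : GroupCorner X G I) (a b : MonoidAlgebra K X) {i : MonoidAlgebra K X}
    (hi : i ∈ Submodule.span K (of K X '' I)) : a * i * b ∈ Submodule.span K (of K X '' I) := by
  induction hi using Submodule.span_induction with
  | mem i hi =>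
    obtain ⟨i, hi, rfl⟩ := hi
    induction a using MonoidAlgebra.induction_on with
    | of x =>
      induction b using MonoidAlgebra.induction_on with
      | of y =>
        rw [← map_mul, ← map_mul]
        exact Submodule.subset_span ⟨_, C.mul_mem_right _ _ (C.mul_mem_left _ _ hi), rfl⟩
      | add b c hb hc => rw [mul_add]; exact add_mem hb hc
      | smul r b hb => rw [mul_smul_comm]; exact Submodule.smul_mem _ _ hb
    | add a c ha hc => rw [add_mul, add_mul]; exact add_mem ha hc
    | smul r a ha => rw [smul_mul_assoc, smul_mul_assoc]; exact Submodule.smul_mem _ _ ha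
  | zero => simp
  | add i j _ _ hi hj => rw [mul_add, add_mul]; exact add_mem hi hj
  | smul r i _ hi => rw [mul_smul_comm, smul_mul_assoc]; exact Submodule.smul_mem _ _ hi

theorem proj_eq_zero {i : MonoidAlgebra K X} (hi : i ∈ Submodule.span K (of K X '' I)) :
    C.proj K i = 0 := by
  induction hi using Submodule.span_induction with
  | mem i hi => obtain ⟨i, hi, rfl⟩ := hi; exact C.proj_of_mem K hi
  | zero => simp
  | add i j _ _ hi hj => rw [map_add, hi, hj, add_zero]
  | smul r i _ hi => rw [map_smul, hi, smul_zero]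

/-- On the corner, `proj` is linear for right multiplication by the group algebra, since the error
term lies in the ideal spanned by `I`, which `proj` kills. -/
theorem proj_corner_mul_incl (a : MonoidAlgebra K X) (y : MonoidAlgebra K G) :
    C.proj K (C.idem K * a * C.incl K y) = C.proj K (C.idem K * a * C.idem K) * y := by
  have h := C.proj_eq_zero K (C.mul_mem_span K 1 (C.incl K y) (C.corner_mem_span K a))
  rwa [one_mul, sub_mul, map_sub, mul_assoc _ (C.idem K), idem_mul_incl, ← map_mul, proj_incl,
    sub_eq_zero] at h

/-- The largest left ideal of the monoid algebra whose corner lies in a given left ideal `m` of the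
group algebra. -/
noncomputable def coind (m : Ideal (MonoidAlgebra K G)) : Ideal (MonoidAlgebra K X) where
  carrier := {x | ∀ a, C.proj K (C.idem K * a * x * C.idem K) ∈ m}
  zero_mem' := by simp
  add_mem' := fun {x y} hx hy a => by
    rw [mul_add, add_mul, map_add]; exact add_mem (hx a) (hy a)
  smul_mem' := fun c x hx a => by
    rw [smul_eq_mul, ← mul_assoc, mul_assoc _ a]; exact hx (a * c)

variable {K} {m : Ideal (MonoidAlgebra K G)}

theorem mem_coind {x : MonoidAlgebra K X} :
    x ∈ C.coind K m ↔ ∀ a, C.proj K (C.idem K * a * x * C.idem K) ∈ m := Iff.rfl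

theorem one_sub_idem_mem_coind : 1 - C.idem K ∈ C.coind K m := fun a => by
  rw [mul_assoc, sub_mul, one_mul, idem_mul_idem, sub_self, mul_zero, map_zero]
  exact zero_mem m

theorem span_le_coind {x : MonoidAlgebra K X} (hx : x ∈ Submodule.span K (of K X '' I)) :
    x ∈ C.coind K m := fun a => by
  rw [C.proj_eq_zero K (C.mul_mem_span K _ _ hx)]
  exact zero_mem m

theorem incl_mem_coind {y : MonoidAlgebra K G} : C.incl K y ∈ C.coind K m ↔ y ∈ m := by
  refine ⟨fun h => ?_, fun h a => ?_⟩
  · simpa [idem_mul_incl, incl_mul_idem, proj_incl] using h 1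
  · rw [mul_assoc _ (C.incl K y), incl_mul_idem, proj_corner_mul_incl]
    exact m.mul_mem_left _ h

/-- A strictly larger left ideal `N` contains `1 - e` and the span of `I`, so together with `x` it
contains a group algebra element outside `m`. Its trace on the group algebra is then everything,
whence `e ∈ N` and `1 ∈ N`. -/
theorem isMaximal_coind (hm : m.IsMaximal) : (C.coind K m).IsMaximal := by
  rw [Ideal.isMaximal_iff] at hm ⊢
  have hone : (1 : MonoidAlgebra K X) ∉ C.coind K m := fun h => hm.1 <| by
    rw [← C.incl_mem_coind, incl_one, ← mul_one (C.idem K)]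
    exact Ideal.mul_mem_left _ _ h
  refine ⟨hone, fun N x hN hx hxN => ?_⟩
  rw [mem_coind] at hx
  push Not at hx
  obtain ⟨a, ha⟩ := hx
  set y := C.proj K (C.idem K * a * x * C.idem K)
  have h1 : C.idem K * a * x * C.idem K ∈ N := by
    have h2 : C.idem K * a * x * C.idem K =
        C.idem K * a * x - C.idem K * a * x * (1 - C.idem K) := by
      rw [mul_sub, mul_one, sub_sub_cancel]
    rw [h2]
    exact sub_mem (N.mul_mem_left _ hxN) (N.mul_mem_left _ (hN C.one_sub_idem_mem_coind))
  have hy : C.incl K y ∈ N := by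
    have h3 := C.corner_mem_span K (a * x)
    rw [← mul_assoc] at h3
    have h4 := sub_mem h1 (hN (C.span_le_coind h3))
    rwa [sub_sub_cancel] at h4
  have h5 : (1 : MonoidAlgebra K G) ∈ N.toAddSubgroup.comap (C.incl K : MonoidAlgebra K G →+ _) := by
    let N' : Ideal (MonoidAlgebra K G) :=
      { carrier := {z | C.incl K z ∈ N}
        zero_mem' := by simp
        add_mem' := fun {x y} hx hy => by
          change C.incl K (x + y) ∈ N
          rw [map_add]; exact add_mem hx hy
        smul_mem' := fun c x hx => by
          change C.incl K (c * x) ∈ N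
          rw [map_mul]; exact N.mul_mem_left _ hx }
    exact hm.2 N' y (fun z hz => hN (C.incl_mem_coind.2 hz)) ha hy
  have h6 : C.idem K ∈ N := by rw [← incl_one]; exact h5
  have h7 := add_mem (hN (C.one_sub_idem_mem_coind (m := m))) h6
  rwa [sub_add_cancel] at h7

/-- If the isomorphism sends the class of `1` to that of `c`, then right multiplication by the
compression `b` of `c` to the group algebra induces the isomorphism below. -/
theorem nonempty_equiv_of_coind {m₁ m₂ : Ideal (MonoidAlgebra K G)} (h₁ : m₁.IsMaximal)
    (h₂ : m₂.IsMaximal)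
    (f : (MonoidAlgebra K X ⧸ C.coind K m₁) ≃ₗ[MonoidAlgebra K X]
      (MonoidAlgebra K X ⧸ C.coind K m₂)) :
    Nonempty ((MonoidAlgebra K G ⧸ m₁) ≃ₗ[MonoidAlgebra K G] (MonoidAlgebra K G ⧸ m₂)) := by
  obtain ⟨c, hc⟩ := (C.coind K m₂).mkQ_surjective (f ((C.coind K m₁).mkQ 1))
  set b := C.proj K (C.idem K * c * C.idem K)
  have hb (y : MonoidAlgebra K G) : y ∈ m₁ ↔ y * b ∈ m₂ := by
    have h1 : C.incl K y * c - C.incl K (y * b) ∈ C.coind K m₂ := by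
      have h2 : C.incl K y * c - C.incl K (y * b) = C.incl K y * c * (1 - C.idem K) +
          C.incl K y * (C.idem K * c * C.idem K - C.incl K b) := by
        rw [mul_sub, mul_sub, map_mul, ← mul_assoc, ← mul_assoc, incl_mul_idem, mul_one]
        abel
      rw [h2]
      exact add_mem (Ideal.mul_mem_left _ _ C.one_sub_idem_mem_coind)
        (Ideal.mul_mem_left _ _ (C.span_le_coind (C.corner_mem_span K c)))
    rw [← C.incl_mem_coind (m := m₁), ← C.incl_mem_coind (m := m₂)]
    have h3 : C.incl K (y * b) ∈ C.coind K m₂ ↔ C.incl K y * c ∈ C.coind K m₂ :=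
      ⟨fun h => by simpa using add_mem h1 h, fun h => by simpa using sub_mem h h1⟩
    rw [h3, ← Submodule.Quotient.mk_eq_zero, ← Submodule.Quotient.mk_eq_zero (C.coind K m₂),
      ← smul_eq_mul, Submodule.Quotient.mk_smul]
    rw [show Submodule.Quotient.mk c = f ((C.coind K m₁).mkQ 1) from hc, ← map_smul,
      f.map_eq_zero_iff, ← map_smul, smul_eq_mul, mul_one]
    rfl
  let φ : MonoidAlgebra K G →ₗ[MonoidAlgebra K G] (MonoidAlgebra K G ⧸ m₂) :=
    m₂.mkQ ∘ₗ LinearMap.toSpanSingleton _ _ b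
  have hker : LinearMap.ker φ = m₁ := by
    ext y
    rw [LinearMap.mem_ker, hb]
    exact Submodule.Quotient.mk_eq_zero m₂
  have : IsSimpleModule (MonoidAlgebra K G) (MonoidAlgebra K G ⧸ m₂) :=
    isSimpleModule_iff_isCoatom.2 h₂.out
  have hsurj : Function.Surjective φ := (LinearMap.surjective_or_eq_zero φ).resolve_right fun h =>
    h₁.ne_top (by rw [← hker, h, LinearMap.ker_zero])
  exact ⟨(Submodule.quotEquivOfEq _ _ hker.symm).trans (φ.quotKerEquivOfSurjective hsurj)⟩

end GroupCorner

/-! ### Apexes in monoids whose cells are ordered by a rank -/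

section Apex

open MonoidAlgebra (of)

theorem spanAnnihilates_iff (K : Type u) [Field K] {X : Type v} [Monoid X] (J : Set X)
    (M : Type w) [AddCommGroup M] [Module (MonoidAlgebra K X) M] :
    SpanAnnihilates K J M ↔ ∀ a ∈ J, ∀ m : M, of K X a • m = 0 := by
  refine ⟨fun h a ha => h _ (Submodule.subset_span ⟨a, ha, rfl⟩), fun h x hx m => ?_⟩
  induction hx using Submodule.span_induction with
  | mem x hx => obtain ⟨a, ha, rfl⟩ := hx; exact h a ha m
  | zero => rw [zero_smul]
  | add x y _ _ hx hy => rw [add_smul, hx, hy, add_zero]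
  | smul c x _ hx => rw [Algebra.smul_def, mul_smul, hx, smul_zero]

/-- A function on a monoid, onto `{1, …, n}`, that determines the two-sided preorder. -/
structure IsRank {X : Type v} [Monoid X] (rk : X → ℕ) (n : ℕ) : Prop where
  le_iff : ∀ a b : X, TwoSidedLE a b ↔ rk b ≤ rk a
  one_le : ∀ a, 1 ≤ rk a
  le : ∀ a, rk a ≤ n
  exists_eq : ∀ l, 1 ≤ l → l ≤ n → ∃ a, rk a = l

namespace IsRank

variable {X : Type v} [Monoid X] {rk : X → ℕ} {n : ℕ}

theorem isJCell_iff (h : IsRank rk n) {J : Set X} :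
    IsJCell J ↔ ∃ l, 1 ≤ l ∧ l ≤ n ∧ J = {a | rk a = l} := by
  have key (a : X) : {b : X | TwoSidedLE a b ∧ TwoSidedLE b a} = {b | rk b = rk a} := by
    ext b
    simp only [Set.mem_ofPred_eq, h.le_iff]
    omega
  constructor
  · rintro ⟨a, rfl⟩
    exact ⟨rk a, h.one_le a, h.le a, key a⟩
  · rintro ⟨l, h1, h2, rfl⟩
    obtain ⟨a, rfl⟩ := h.exists_eq l h1 h2
    exact ⟨a, (key a).symm⟩

theorem jCellLE_iff (h : IsRank rk n) {l m : ℕ} (hl : 1 ≤ l) (hln : l ≤ n) (hm : 1 ≤ m)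
    (hmn : m ≤ n) : JCellLE {a | rk a = l} {a | rk a = m} ↔ m ≤ l := by
  constructor
  · rintro ⟨a, rfl, b, rfl, hab⟩
    exact (h.le_iff a b).1 hab
  · intro hml
    obtain ⟨a, ha⟩ := h.exists_eq l hl hln
    obtain ⟨b, hb⟩ := h.exists_eq m hm hmn
    exact ⟨a, ha, b, hb, (h.le_iff a b).2 (by omega)⟩

theorem setOf_injective (h : IsRank rk n) {l m : ℕ} (hl : 1 ≤ l) (hln : l ≤ n)
    (hlm : {a | rk a = l} = {a | rk a = m}) : l = m := by
  obtain ⟨a, ha⟩ := h.exists_eq l hl hln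
  have : a ∈ {a | rk a = m} := hlm ▸ ha
  exact ha.symm.trans this

variable (K : Type u) [Field K] (M : Type w) [AddCommGroup M] [Module (MonoidAlgebra K X) M]

theorem smul_eq_zero_of_le {K : Type u} [Field K] {M : Type w} [AddCommGroup M]
    [Module (MonoidAlgebra K X) M] (h : IsRank rk n) {a b : X} (hab : rk b ≤ rk a)
    (ha : ∀ m : M, of K X a • m = 0) (m : M) : of K X b • m = 0 := by
  obtain ⟨c, d, rfl⟩ := (h.le_iff a b).2 hab
  rw [map_mul, map_mul, mul_smul, mul_smul, ha, smul_zero]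

/-- An element that acts as zero forces the same on every element of at most its rank, so one
representative decides for its cell. Larger cells are those of smaller rank, hence maximality
concerns ranks below `l`. -/
theorem isApex_iff (h : IsRank rk n) {e : X} {l : ℕ} (he : rk e = l) :
    IsApex K M {a | rk a = l} ↔
      (∀ x ∈ {x | rk x < l}, ∀ m : M, of K X x • m = 0) ∧ ∃ m : M, of K X e • m ≠ 0 := by
  subst he
  have he : ¬ SpanAnnihilates K {a | rk a = rk e} M ↔ ∃ m : M, of K X e • m ≠ 0 := by
    rw [not_iff_comm, spanAnnihilates_iff]
    push Not
    exact ⟨fun h1 a ha => h.smul_eq_zero_of_le (le_of_eq ha) h1, fun h1 => h1 e rfl⟩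
  rw [IsApex, he]
  constructor
  · rintro ⟨-, h1, h2⟩
    refine ⟨fun x hx m => ?_, h1⟩
    by_contra hm
    have h3 := h2 {a | rk a = rk x} (h.isJCell_iff.2 ⟨_, h.one_le x, h.le x, rfl⟩)
      (fun h4 => hm ((spanAnnihilates_iff K _ M).1 h4 x rfl m))
      ((h.jCellLE_iff (h.one_le e) (h.le e) (h.one_le x) (h.le x)).2 (le_of_lt hx))
    exact absurd (h.setOf_injective (h.one_le x) (h.le x) h3) (ne_of_lt hx)
  · rintro ⟨h1, h2⟩
    refine ⟨h.isJCell_iff.2 ⟨_, h.one_le e, h.le e, rfl⟩, h2, fun J hJ h3 h4 => ?_⟩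
    obtain ⟨l, hl, hln, rfl⟩ := h.isJCell_iff.1 hJ
    rw [h.jCellLE_iff (h.one_le e) (h.le e) hl hln] at h4
    rcases h4.lt_or_eq with h5 | rfl
    · refine absurd ((spanAnnihilates_iff K _ M).2 fun a ha m => h1 a ?_ m) h3
      simp only [Set.mem_ofPred_eq] at ha ⊢
      omega
    · rfl

/-- The apex is the cell of the least rank acting nontrivially; such a rank exists because `1` acts
as the identity. -/
theorem existsUnique_isApex [Nontrivial M] (h : IsRank rk n) : ∃! J : Set X, IsApex K M J := by
  classical
  have hex : ∃ l, ∃ e : X, rk e = l ∧ ∃ m : M, of K X e • m ≠ 0 := by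
    obtain ⟨m, hm⟩ := exists_ne (0 : M)
    exact ⟨_, 1, rfl, m, by rwa [map_one, one_smul]⟩
  obtain ⟨e, he, hem⟩ := Nat.find_spec hex
  have hmin {x : X} (hx : rk x < rk e) (m : M) : of K X x • m = 0 := by
    by_contra hm
    exact Nat.find_min hex (he ▸ hx) ⟨x, rfl, m, hm⟩
  refine ⟨{a | rk a = rk e}, (h.isApex_iff K M rfl).2 ⟨fun x hx m => hmin hx m, hem⟩, fun J hJ => ?_⟩
  obtain ⟨l, hl, hln, rfl⟩ := h.isJCell_iff.1 hJ.1
  obtain ⟨b, rfl⟩ := h.exists_eq l hl hln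
  obtain ⟨h1, m, hm⟩ := (h.isApex_iff K M rfl).1 hJ
  rcases lt_trichotomy (rk b) (rk e) with h2 | h2 | h2
  · exact absurd (hmin h2 m) hm
  · rw [h2]
  · obtain ⟨m', hm'⟩ := hem
    exact absurd (h1 e h2 m') hm'

end IsRank

/-! ### Counting simple modules with a given apex -/

section Counting

variable {K : Type u} [Field K] {X : Type} [Monoid X] {rk : X → ℕ} {n : ℕ} {G : Type w} [Group G]

/-- The simple module with given apex that corresponds to a maximal left ideal of the algebra of
the group in the apex. -/
noncomputable def GroupCorner.simpleWithApex (h : IsRank rk n) {l : ℕ}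
    (C : GroupCorner X G {x | rk x < l}) (hC : rk (C.toFun 1) = l)
    (m : {m : Ideal (MonoidAlgebra K G) // m.IsMaximal}) : SimpleWithApex K {x | rk x = l} :=
  ⟨ModuleCat.of _ (MonoidAlgebra K X ⧸ C.coind K m.1),
    isSimpleModule_iff_isCoatom.2 (C.isMaximal_coind m.2).out, by
      refine (h.isApex_iff K _ hC).2 ⟨fun x hx a => ?_, (C.coind K m.1).mkQ 1, ?_⟩
      · obtain ⟨a, rfl⟩ := (C.coind K m.1).mkQ_surjective a
        rw [← map_smul, Submodule.mkQ_apply, Submodule.Quotient.mk_eq_zero]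
        have := C.mul_mem_span K 1 a (Submodule.subset_span ⟨x, hx, rfl⟩)
        rw [one_mul] at this
        exact C.span_le_coind this
      · rw [← map_smul, Submodule.mkQ_apply, Ne, Submodule.Quotient.mk_eq_zero, smul_eq_mul, mul_one,
          ← C.incl_of K, C.incl_mem_coind, map_one, ← Ideal.eq_top_iff_one]
        exact m.2.ne_top⟩

theorem exists_isApex_of_groupCorner (h : IsRank rk n) {l : ℕ}
    (C : GroupCorner X G {x | rk x < l}) (hC : rk (C.toFun 1) = l) :
    ∃ M : ModuleCat.{u} (MonoidAlgebra K X),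
      IsSimpleModule (MonoidAlgebra K X) M ∧ IsApex K M {x | rk x = l} := by
  obtain ⟨m, hm⟩ := Ideal.exists_maximal (MonoidAlgebra K G)
  exact ⟨_, (C.simpleWithApex (K := K) h hC ⟨m, hm⟩).2⟩

/-- The simple modules with given apex are counted by any upper bound in terms of classes of group
elements that is attained by pairwise non-isomorphic simple modules of the group. -/
theorem card_simpleClassesWithApex [Finite X] (h : IsRank rk n) {l : ℕ}
    (C : GroupCorner X G {x | rk x < l}) (hC : rk (C.toFun 1) = l) {R : Type*} [Fintype R]
    (s : R → G) (hs : ∀ g, ∃ r, TraceEquivalent (ringChar K) g (s r)) {D : Type*} [Fintype D]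
    (hD : Fintype.card R ≤ Fintype.card D)
    (m : D → {m : Ideal (MonoidAlgebra K G) // m.IsMaximal})
    (hm : ∀ i j, Nonempty ((MonoidAlgebra K G ⧸ (m i).1) ≃ₗ[MonoidAlgebra K G]
      (MonoidAlgebra K G ⧸ (m j).1)) → i = j) :
    Finite (SimpleClassesWithApex K {x | rk x = l}) ∧
      Nat.card (SimpleClassesWithApex K {x | rk x = l}) = Fintype.card D := by
  let f : D → SimpleClassesWithApex K {x | rk x = l} := fun d =>
    Quotient.mk _ (C.simpleWithApex h hC (m d))
  have hf : Function.Injective f := fun i j hij => by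
    obtain ⟨e⟩ := Quotient.exact hij
    exact hm i j (C.nonempty_equiv_of_coind (m i).2 (m j).2 e)
  -- The bound is proved for finite sets of classes because finiteness is not yet known; it follows
  -- from the uniform bound.
  have hle (t : Finset (SimpleClassesWithApex K {x | rk x = l})) : t.card ≤ Fintype.card R := by
    have := fun j : t => j.1.out.2.1
    rw [← Fintype.card_coe]
    refine card_le_of_simple_of_groupCorner K C s hs (fun j : t => (j.1.out.1 : Type u)) ?_ ?_ ?_
    · refine fun i j hij => ⟨fun e => hij (Subtype.ext ?_)⟩
      rw [← Quotient.out_eq i.1, ← Quotient.out_eq j.1]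
      exact Quotient.sound ⟨e⟩
    · intro j
      exact ((h.isApex_iff K _ hC).1 j.1.out.2.2).1
    · intro j
      exact ((h.isApex_iff K _ hC).1 j.1.out.2.2).2
  have hfin : Finite (SimpleClassesWithApex K {x | rk x = l}) := by
    by_contra hinf
    rw [not_finite_iff_infinite] at hinf
    obtain ⟨t, ht⟩ := Infinite.exists_subset_card_eq (SimpleClassesWithApex K {x | rk x = l})
      (Fintype.card R + 1)
    have := hle t
    omega
  refine ⟨hfin, le_antisymm ?_ ?_⟩
  · have := Fintype.ofFinite (SimpleClassesWithApex K {x | rk x = l})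
    rw [Nat.card_eq_fintype_card]
    exact (hle Finset.univ).trans hD
  · rw [← Nat.card_eq_fintype_card]
    exact Nat.card_le_card_of_injective f hf

end Counting

end Apex

/-! ### Ranks and group corners of the transformation monoids -/

section Transformations

variable {n : ℕ}

/-- The idempotent transformation `i ↦ min i (l - 1)`. -/
def truncation (n l : ℕ) : TransformationMonoid n :=
  fun i => ⟨min i (l - 1), lt_of_le_of_lt (min_le_left _ _) i.2⟩

theorem throughStrands_le (a : TransformationMonoid n) : throughStrands a ≤ n := by
  refine Finset.card_image_le.trans ?_
  simp

theorem one_le_throughStrands (hn : 1 ≤ n) (a : TransformationMonoid n) : 1 ≤ throughStrands a :=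
  Finset.card_pos.2 ⟨a ⟨0, hn⟩, Finset.mem_image_of_mem _ (Finset.mem_univ _)⟩

theorem throughStrands_mul_le_left (a b : TransformationMonoid n) :
    throughStrands (a * b) ≤ throughStrands a :=
  Finset.card_le_card fun x hx => by
    obtain ⟨i, -, rfl⟩ := Finset.mem_image.1 hx
    exact Finset.mem_image.2 ⟨b i, Finset.mem_univ _, rfl⟩

theorem throughStrands_mul_le_right (a b : TransformationMonoid n) :
    throughStrands (a * b) ≤ throughStrands b := by
  have : (Finset.univ.image fun i => a (b i)) = (Finset.univ.image fun i => b i).image a :=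
    Finset.image_image.symm
  exact (congrArg Finset.card this).trans_le Finset.card_image_le

theorem throughStrands_le_of_twoSidedLE {a b : TransformationMonoid n} (h : TwoSidedLE a b) :
    throughStrands b ≤ throughStrands a := by
  obtain ⟨c, d, rfl⟩ := h
  exact (throughStrands_mul_le_left _ _).trans (throughStrands_mul_le_right _ _)

theorem throughStrands_eq_of_image {l : ℕ} {f : TransformationMonoid n} (hf : ∀ i, (f i : ℕ) < l)
    (hs : ∀ j < l, ∃ i, (f i : ℕ) = j) : throughStrands f = l := by
  rw [throughStrands, ← Finset.card_map Fin.valEmbedding, ← Finset.card_range l]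
  congr 1
  ext j
  simp only [Finset.mem_map, Finset.mem_image, Finset.mem_univ, true_and, Finset.mem_range]
  constructor
  · rintro ⟨_, ⟨i, rfl⟩, rfl⟩
    exact hf i
  · intro hj
    obtain ⟨i, hi⟩ := hs j hj
    exact ⟨f i, ⟨i, rfl⟩, hi⟩

theorem throughStrands_truncation {l : ℕ} (hl : 1 ≤ l) (hln : l ≤ n) :
    throughStrands (truncation n l) = l := by
  refine throughStrands_eq_of_image (fun i => ?_) fun j hj => ⟨⟨j, by omega⟩, ?_⟩ <;> simp [truncation] <;> omega

theorem truncation_mem (l : ℕ) : truncation n l ∈ PlanarTransformationMonoid n := fun i j hij => by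
  simp only [truncation, Fin.mk_le_mk]
  exact min_le_min_right _ hij

/-- A transformation with `l` through strands can be reduced to the truncation, in an
order-preserving way if it preserves the order. -/
theorem exists_mul_mul_eq_truncation (a : TransformationMonoid n) (hn : 1 ≤ n) :
    ∃ c d : TransformationMonoid n, truncation n (throughStrands a) = c * a * d ∧
      c ∈ PlanarTransformationMonoid n ∧
        (a ∈ PlanarTransformationMonoid n → d ∈ PlanarTransformationMonoid n) := by
  set S := Finset.univ.image fun i : Fin n => a i with hS
  have hcard : S.card = throughStrands a := rfl
  have hpos := one_le_throughStrands hn a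
  let s : Fin S.card ↪o Fin n := S.orderEmbOfFin rfl
  have hs (i : Fin S.card) : ∃ j, a j = s i := by
    have := S.orderEmbOfFin_mem rfl i
    obtain ⟨j, -, hj⟩ := Finset.mem_image.1 this
    exact ⟨j, hj⟩
  choose t ht using hs
  let q (i : Fin n) : Fin S.card := ⟨min i (throughStrands a - 1), by omega⟩
  have hq {i j : Fin n} (hij : i ≤ j) : q i ≤ q j := Fin.mk_le_mk.2 (min_le_min_right _ hij)
  have hlt (x : Fin n) : (S.filter (· < x)).card ≤ x := by
    refine (Finset.card_le_card (t := Finset.Iio x) fun y hy => ?_).trans (by simp)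
    simpa using (Finset.mem_filter.1 hy).2
  -- The left factor sends the `i`-th point of the image of `a` to `i`; the right factor chooses a
  -- preimage of that point, repeating the last one for large indices.
  refine ⟨fun x => ⟨(S.filter (· < x)).card, (hlt x).trans_lt x.2⟩, fun i => t (q i), ?_, ?_, ?_⟩
  · funext i
    apply Fin.ext
    change min (i : ℕ) _ = (S.filter (· < a (t (q i)))).card
    have : S.filter (· < s (q i)) = (Finset.Iio (q i)).map s.toEmbedding := by
      ext y
      simp only [Finset.mem_filter, Finset.mem_map, Finset.mem_Iio]
      constructor
      · rintro ⟨hy, hlt⟩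
        have : y ∈ Set.range s := by rw [S.range_orderEmbOfFin rfl]; exact hy
        obtain ⟨k, rfl⟩ := this
        exact ⟨k, s.lt_iff_lt.1 hlt, rfl⟩
      · rintro ⟨k, hk, rfl⟩
        exact ⟨S.orderEmbOfFin_mem rfl k, s.lt_iff_lt.2 hk⟩
    rw [ht, this, Finset.card_map, Fin.card_Iio]
  · intro x y hxy
    exact Fin.mk_le_mk.2 (Finset.card_le_card fun z hz => by
      rw [Finset.mem_filter] at hz ⊢
      exact ⟨hz.1, hz.2.trans_le hxy⟩)
  · intro ha i j hij
    rcases (hq hij).lt_or_eq with h | h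
    · by_contra! hlt
      have := ha _ _ hlt.le
      rw [ht, ht, s.le_iff_le] at this
      exact absurd h this.not_gt
    · change t (q i) ≤ t (q j)
      rw [h]

/-- Factor `b` through its image: `d` gives the position of `b i` in the sorted image and `c`
enumerates the image. Positions are less than `l`, so the truncation fixes them. -/
theorem exists_eq_mul_truncation_mul (b : TransformationMonoid n) (hn : 1 ≤ n) {l : ℕ}
    (hl : throughStrands b ≤ l) :
    ∃ c d : TransformationMonoid n, b = c * truncation n l * d ∧
      c ∈ PlanarTransformationMonoid n ∧
        (b ∈ PlanarTransformationMonoid n → d ∈ PlanarTransformationMonoid n) := by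
  set S := Finset.univ.image fun i : Fin n => b i with hS
  have hcard : S.card = throughStrands b := rfl
  have hpos := one_le_throughStrands hn b
  have hle := throughStrands_le b
  let s : Fin S.card ↪o Fin n := S.orderEmbOfFin rfl
  have hs (i : Fin n) : ∃ j, s j = b i := by
    have : b i ∈ Set.range s := by
      rw [S.range_orderEmbOfFin rfl]
      exact Finset.mem_image_of_mem _ (Finset.mem_univ i)
    exact this
  choose t ht using hs
  let q (i : Fin n) : Fin S.card := ⟨min i (throughStrands b - 1), by omega⟩
  have hq {i j : Fin n} (hij : i ≤ j) : q i ≤ q j := Fin.mk_le_mk.2 (min_le_min_right _ hij)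
  refine ⟨fun i => s (q i), fun i => (t i).castLE (by omega), ?_, fun i j hij => s.le_iff_le.2 (hq hij),
    fun hb i j hij => ?_⟩
  · funext i
    rw [← ht i]
    change _ = s (q (truncation n l ((t i).castLE _)))
    congr 1
    apply Fin.ext
    have := (t i).2
    simp [q, truncation]
    omega
  · have := hb i j hij
    rw [← ht, ← ht, s.le_iff_le] at this
    exact this

theorem isRank_throughStrands (hn : 1 ≤ n) : IsRank (throughStrands (n := n)) n where
  le_iff a b := by
    refine ⟨throughStrands_le_of_twoSidedLE, fun h => ?_⟩
    obtain ⟨c, d, h1, -⟩ := exists_mul_mul_eq_truncation a hn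
    obtain ⟨c', d', h2, -⟩ := exists_eq_mul_truncation_mul b hn h
    exact ⟨c' * c, d * d', by rw [h2, h1]; simp only [mul_assoc]⟩
  one_le := one_le_throughStrands hn
  le := throughStrands_le
  exists_eq l hl hln := ⟨_, throughStrands_truncation hl hln⟩

theorem isRank_throughStrands_planar (hn : 1 ≤ n) :
    IsRank (fun a : PlanarTransformationMonoid n => throughStrands (a : TransformationMonoid n)) n where
  le_iff a b := by
    constructor
    · rintro ⟨c, d, rfl⟩
      exact throughStrands_le_of_twoSidedLE ⟨c, d, rfl⟩
    · intro h
      obtain ⟨c, d, h1, hc, hd⟩ := exists_mul_mul_eq_truncation (a : TransformationMonoid n) hn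
      obtain ⟨c', d', h2, hc', hd'⟩ := exists_eq_mul_truncation_mul (b : TransformationMonoid n) hn h
      refine ⟨⟨c', hc'⟩ * ⟨c, hc⟩, ⟨d, hd a.2⟩ * ⟨d', hd' b.2⟩, Subtype.ext ?_⟩
      change (b : TransformationMonoid n) = c' * c * a * (d * d')
      rw [h2, h1]; simp only [mul_assoc]
  one_le a := one_le_throughStrands hn _
  le a := throughStrands_le _
  exists_eq l hl hln := ⟨⟨_, truncation_mem l⟩, throughStrands_truncation hl hln⟩

/-- The transformation that permutes the first `l` points and sends all others where it sends the
last of these. -/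
def permTransformation {l : ℕ} (hl : 1 ≤ l) (hln : l ≤ n) (σ : Equiv.Perm (Fin l)) :
    TransformationMonoid n :=
  fun i => (σ ⟨min i (l - 1), by omega⟩).castLE hln

theorem permTransformation_one {l : ℕ} (hl : 1 ≤ l) (hln : l ≤ n) :
    permTransformation hl hln 1 = truncation n l := rfl

/-- An element of the corner is determined by a self-map of the first `l` points; rank at least `l`
makes that map surjective. -/
theorem exists_eq_permTransformation {l : ℕ} (hl : 1 ≤ l) (hln : l ≤ n) (x : TransformationMonoid n)
    (hx : l ≤ throughStrands (truncation n l * x * truncation n l)) :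
    ∃ σ, truncation n l * x * truncation n l = permTransformation hl hln σ := by
  set y := truncation n l * x * truncation n l with hy
  have hlt (i : Fin n) : (y i : ℕ) < l := by
    change min _ _ < l
    omega
  let f : Fin l → Fin l := fun i => ⟨y (i.castLE hln), hlt _⟩
  have hf (i : Fin n) : y i = (f ⟨min i (l - 1), by omega⟩).castLE hln := by
    change truncation n l (x (truncation n l _)) = truncation n l (x (truncation n l _))
    congr 2
    apply Fin.ext
    simp [truncation]
  have h1 : (Finset.univ.image fun i : Fin n => y i) ⊆
      (Finset.univ.image f).map (Fin.castLEEmb hln) := by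
    intro z hz
    obtain ⟨i, -, rfl⟩ := Finset.mem_image.1 hz
    rw [hf]
    exact Finset.mem_map_of_mem _ (Finset.mem_image_of_mem _ (Finset.mem_univ _))
  have h2 : l ≤ (Finset.univ.image f).card := by
    simpa using hx.trans (Finset.card_le_card h1)
  have hsurj : Function.Surjective f := by
    have h3 : Finset.univ.image f = Finset.univ :=
      Finset.eq_univ_of_card _ (le_antisymm (Finset.card_le_univ _) (by simpa using h2))
    intro j
    obtain ⟨i, -, hi⟩ := Finset.mem_image.1 (h3 ▸ Finset.mem_univ j)
    exact ⟨i, hi⟩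
  exact ⟨Equiv.ofBijective f (Finite.surjective_iff_bijective.1 hsurj), funext hf⟩

theorem throughStrands_permTransformation {l : ℕ} (hl : 1 ≤ l) (hln : l ≤ n)
    (σ : Equiv.Perm (Fin l)) : throughStrands (permTransformation hl hln σ) = l := by
  refine throughStrands_eq_of_image (fun i => (σ _).2) fun j hj => ⟨(σ⁻¹ ⟨j, hj⟩).castLE hln, ?_⟩
  have : (⟨min (σ⁻¹ ⟨j, hj⟩) (l - 1), by omega⟩ : Fin l) = σ⁻¹ ⟨j, hj⟩ := by
    apply Fin.ext
    simp
    omega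
  change ((σ ⟨min (σ⁻¹ ⟨j, hj⟩) (l - 1), _⟩ : Fin l) : ℕ) = j
  rw [this]
  simp

theorem permTransformation_castLE {l : ℕ} (hl : 1 ≤ l) (hln : l ≤ n) (σ : Equiv.Perm (Fin l))
    (i : Fin l) : permTransformation hl hln σ (i.castLE hln) = (σ i).castLE hln := by
  have : (⟨min i (l - 1), by omega⟩ : Fin l) = i := by
    apply Fin.ext
    simp
    omega
  change (σ ⟨min i (l - 1), _⟩).castLE hln = _
  rw [this]

/-- The symmetric group on `l` letters in the cell with `l` through strands. -/
def permCorner {l : ℕ} (hl : 1 ≤ l) (hln : l ≤ n) :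
    GroupCorner (TransformationMonoid n) (Equiv.Perm (Fin l)) {x | throughStrands x < l} where
  toFun := permTransformation hl hln
  toFun_mul σ τ := by
    funext i
    exact (permTransformation_castLE hl hln σ (τ ⟨min i (l - 1), by omega⟩)).symm
  injective σ τ h := by
    ext i
    have := congrFun h (i.castLE hln)
    rw [permTransformation_castLE, permTransformation_castLE] at this
    exact congrArg (fun j : Fin n => (j : ℕ)) this
  notMem σ h := (throughStrands_permTransformation hl hln σ).not_lt h
  mul_mem_left x y hy := (throughStrands_mul_le_right x y).trans_lt hy
  mul_mem_right x y hy := (throughStrands_mul_le_left y x).trans_lt hy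
  corner x := by
    rw [permTransformation_one]
    exact (lt_or_ge _ l).imp_right (exists_eq_permTransformation hl hln x)

/-- The cell of planar transformations with `l` through strands contains a trivial group only. -/
def planarCorner {l : ℕ} (hl : 1 ≤ l) (hln : l ≤ n) :
    GroupCorner (PlanarTransformationMonoid n) Unit
      {x | throughStrands (x : TransformationMonoid n) < l} where
  toFun _ := ⟨truncation n l, truncation_mem l⟩
  toFun_mul _ _ := Subtype.ext ((permCorner hl hln).toFun_mul 1 1)
  injective _ _ _ := rfl
  notMem _ h := (throughStrands_truncation hl hln).not_lt h
  mul_mem_left x y hy := (throughStrands_mul_le_right _ _).trans_lt hy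
  mul_mem_right x y hy := (throughStrands_mul_le_left _ _).trans_lt hy
  corner x := by
    refine (lt_or_ge _ l).imp_right fun h => ⟨(), ?_⟩
    obtain ⟨σ, hσ⟩ := exists_eq_permTransformation hl hln (x : TransformationMonoid n) h
    have hmono : Monotone σ := fun i j hij => by
      have h1 : permTransformation hl hln σ ∈ PlanarTransformationMonoid n := by
        rw [← hσ]
        exact mul_mem (mul_mem (truncation_mem l) x.2) (truncation_mem l)
      have h2 := h1 (i.castLE hln) (j.castLE hln) hij
      rw [permTransformation_castLE, permTransformation_castLE] at h2
      exact h2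
    have h3 : σ = 1 := by
      -- A finite chain has only one order automorphism.
      have := Subsingleton.elim
        ((hmono.strictMono_of_injective σ.injective).orderIsoOfSurjective σ σ.surjective)
        (OrderIso.refl (Fin l))
      ext i
      exact congrArg Fin.val (DFunLike.congr_fun this i)
    apply Subtype.ext
    change truncation n l * (x : TransformationMonoid n) * truncation n l = truncation n l
    rw [hσ, h3, permTransformation_one]

end Transformations

/-! ### Permutations acting on functions, and antisymmetrizers -/

section Antisymmetrizer

open MonoidAlgebra (of)
open Equiv (Perm)

variable (K : Type u) [Field K] {α : Type v}

/-- The permutation representation on functions `α → ℕ`. -/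
noncomputable def permRep : MonoidAlgebra K (Perm α) →ₐ[K] Module.End K ((α → ℕ) →₀ K) :=
  MonoidAlgebra.lift K _ _
    { toFun := fun σ => Finsupp.lmapDomain K K fun f => f ∘ ⇑σ⁻¹
      map_one' := by ext; simp
      map_mul' := fun σ τ => by ext; simp [Function.comp_assoc] }

/-- The permutations that preserve a function. -/
def levelStabilizer [Fintype α] [DecidableEq α] (c : α → ℕ) : Finset (Perm α) :=
  Finset.univ.filter fun σ => c ∘ σ = c

theorem mem_levelStabilizer [Fintype α] [DecidableEq α] {c : α → ℕ} {σ : Perm α} :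
    σ ∈ levelStabilizer c ↔ c ∘ σ = c := by
  simp [levelStabilizer]

/-- The antisymmetrizer over the permutations that preserve a function `c`. -/
noncomputable def antisymmetrizer [Fintype α] [DecidableEq α] (c : α → ℕ) : MonoidAlgebra K (Perm α) :=
  ∑ σ ∈ levelStabilizer c, ((Perm.sign σ : ℤ) : K) • of K _ σ

theorem permRep_of_single (σ : Perm α) (f : α → ℕ) (a : K) :
    permRep K (of K _ σ) (Finsupp.single f a) = Finsupp.single (f ∘ ⇑σ⁻¹) a := by
  simp [permRep]

variable [Fintype α] [DecidableEq α]

theorem permRep_antisymmetrizer (c f : α → ℕ) :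
    permRep K (antisymmetrizer K c) (Finsupp.single f 1) =
      ∑ σ ∈ levelStabilizer c, Finsupp.single (f ∘ ⇑σ⁻¹) ((Perm.sign σ : ℤ) : K) := by
  rw [antisymmetrizer, map_sum, LinearMap.sum_apply]
  refine Finset.sum_congr rfl fun σ _ => ?_
  rw [map_smul, LinearMap.smul_apply, permRep_of_single, Finsupp.smul_single, smul_eq_mul, mul_one]

/-- If `f x = f y`, the terms of `σ` and `σ * swap x y` cancel. The pairing has no fixed points, so
characteristic two is no exception. -/
theorem ne_of_permRep_antisymmetrizer_ne_zero {c f : α → ℕ}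
    (h : permRep K (antisymmetrizer K c) (Finsupp.single f 1) ≠ 0) {x y : α} (hxy : x ≠ y)
    (hc : c x = c y) : f x ≠ f y := by
  intro hf
  have hswap {g : α → ℕ} (hg : g x = g y) : g ∘ Equiv.swap x y = g := by
    funext z
    rcases eq_or_ne z x with rfl | hx
    · simp [hg]
    · rcases eq_or_ne z y with rfl | hy
      · simp [hg]
      · simp [Equiv.swap_apply_of_ne_of_ne hx hy]
  refine h ?_
  rw [permRep_antisymmetrizer]
  refine Finset.sum_involution (fun σ _ => σ * Equiv.swap x y) ?_ ?_ ?_ ?_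
  · intro σ _
    have : f ∘ ⇑(σ * Equiv.swap x y)⁻¹ = f ∘ ⇑σ⁻¹ := by
      rw [mul_inv_rev, Equiv.swap_inv, Perm.coe_mul, ← Function.comp_assoc, hswap hf]
    rw [this, ← Finsupp.single_add, Perm.sign_mul, Perm.sign_swap hxy]
    simp
  · intro σ _ _ h1
    rw [mul_eq_left] at h1
    exact hxy (Equiv.swap_eq_one_iff.1 h1)
  · intro σ hσ
    rw [mem_levelStabilizer] at hσ ⊢
    rw [Perm.coe_mul, ← Function.comp_assoc, hσ, hswap hc]
  · intro σ _
    rw [mul_assoc, Equiv.swap_mul_self, mul_one]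

theorem permRep_antisymmetrizer_comp {c : α → ℕ} (f : α → ℕ) {σ : Perm α} (hσ : c ∘ σ = c) :
    permRep K (antisymmetrizer K c) (Finsupp.single (f ∘ σ) 1) =
      ((Perm.sign σ : ℤ) : K) • permRep K (antisymmetrizer K c) (Finsupp.single f 1) := by
  rw [permRep_antisymmetrizer, permRep_antisymmetrizer, Finset.smul_sum]
  refine Finset.sum_bij' (fun τ _ => τ * σ⁻¹) (fun τ _ => τ * σ) ?_ ?_ ?_ ?_ ?_
  · intro τ hτ
    rw [mem_levelStabilizer] at hτ ⊢
    rw [Perm.coe_mul, ← Function.comp_assoc, hτ]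
    nth_rw 1 [← hσ]
    rw [Function.comp_assoc, ← Perm.coe_mul, mul_inv_cancel, Perm.coe_one, Function.comp_id]
  · intro τ hτ
    rw [mem_levelStabilizer] at hτ ⊢
    rw [Perm.coe_mul, ← Function.comp_assoc, hτ, hσ]
  · simp
  · simp
  · intro τ _
    rw [Finsupp.smul_single, mul_inv_rev, inv_inv, Perm.coe_mul, Function.comp_assoc, Perm.sign_mul,
      Perm.sign_inv, smul_eq_mul, ← Int.cast_mul, ← Units.val_mul, mul_left_comm, Int.units_mul_self,
      mul_one]

end Antisymmetrizer

/-! ### Tableaux and dominance -/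

section Tableau

open MonoidAlgebra (of)
open Equiv (Perm)

variable {α : Type v} {μ : YoungDiagram} (t : α ≃ μ.cells)

/-- The row of an entry of a tableau. -/
def tableauRow (x : α) : ℕ := (t x).1.1

/-- The column of an entry of a tableau. -/
def tableauCol (x : α) : ℕ := (t x).1.2

theorem tableau_mem (x : α) : (tableauRow t x, tableauCol t x) ∈ μ := (t x).2

theorem tableau_ext {x y : α} (hr : tableauRow t x = tableauRow t y)
    (hc : tableauCol t x = tableauCol t y) : x = y :=
  t.injective (Subtype.ext (Prod.ext hr hc))

theorem exists_tableau_eq {i j : ℕ} (h : (i, j) ∈ μ) :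
    ∃ x, tableauRow t x = i ∧ tableauCol t x = j :=
  ⟨t.symm ⟨(i, j), h⟩, by simp [tableauRow], by simp [tableauCol]⟩

variable {t} [Fintype α] {f : α → ℕ}

/-- As `f` is injective on a column, at most `k` of its entries have value below `k`, and at most as
many as the column is long. The row function attains the smaller of the two bounds. -/
theorem card_col_le (hf : ∀ x y, x ≠ y → tableauCol t x = tableauCol t y → f x ≠ f y) (j k : ℕ) :
    (Finset.univ.filter fun x => f x < k ∧ tableauCol t x = j).card ≤
      (Finset.univ.filter fun x => tableauRow t x < k ∧ tableauCol t x = j).card := by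
  rcases le_total k (μ.colLen j) with h | h
  · have h1 : (Finset.univ.filter fun x => f x < k ∧ tableauCol t x = j).card ≤
        (Finset.range k).card := by
      refine Finset.card_le_card_of_injOn f (fun x hx => ?_) fun x hx y hy hxy => ?_
      · simp only [Finset.coe_filter, Finset.mem_univ, true_and, Set.mem_ofPred_eq] at hx
        simpa using hx.1
      · simp only [Finset.coe_filter, Finset.mem_univ, true_and, Set.mem_ofPred_eq] at hx hy
        by_contra hne
        exact hf x y hne (hx.2.trans hy.2.symm) hxy
    refine h1.trans (Finset.card_le_card_of_surjOn (tableauRow t) fun i hi => ?_)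
    have hi' : i < k := by simpa using hi
    obtain ⟨x, hx, hxj⟩ := exists_tableau_eq t (YoungDiagram.mem_iff_lt_colLen.2 (hi'.trans_le h))
    exact ⟨x, by simp [hx, hxj, hi'], hx⟩
  · refine Finset.card_le_card fun x hx => ?_
    simp only [Finset.mem_filter, Finset.mem_univ, true_and] at hx ⊢
    refine ⟨lt_of_lt_of_le ?_ h, hx.2⟩
    rw [← hx.2]
    exact YoungDiagram.mem_iff_lt_colLen.1 (tableau_mem t x)

theorem card_filter_lt_eq_sum (g : α → ℕ) (k : ℕ) :
    (Finset.univ.filter fun x => g x < k).card = ∑ j ∈ Finset.univ.image (tableauCol t),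
      (Finset.univ.filter fun x => g x < k ∧ tableauCol t x = j).card := by
  rw [Finset.card_eq_sum_card_fiberwise (f := tableauCol t) (t := Finset.univ.image (tableauCol t))]
  · simp_rw [Finset.filter_filter]
  · intro x _
    simp

theorem card_filter_lt_le (hf : ∀ x y, x ≠ y → tableauCol t x = tableauCol t y → f x ≠ f y)
    (k : ℕ) :
    (Finset.univ.filter fun x => f x < k).card ≤
      (Finset.univ.filter fun x => tableauRow t x < k).card := by
  rw [card_filter_lt_eq_sum (t := t), card_filter_lt_eq_sum (t := t)]
  exact Finset.sum_le_sum fun j _ => card_col_le hf j k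

/-- Equality of the totals forces equality in every column, so `f` stays below the column's length.
Moving each entry within its column to row `f x` is then a permutation. -/
theorem exists_perm_of_card_eq (hf : ∀ x y, x ≠ y → tableauCol t x = tableauCol t y → f x ≠ f y)
    (h : ∀ k, (Finset.univ.filter fun x => f x < k).card =
      (Finset.univ.filter fun x => tableauRow t x < k).card) :
    ∃ σ : Perm α, tableauCol t ∘ σ = tableauCol t ∧ f = tableauRow t ∘ σ := by
  have hcol (j k : ℕ) (hj : j ∈ Finset.univ.image (tableauCol t)) :
      (Finset.univ.filter fun x => f x < k ∧ tableauCol t x = j).card =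
        (Finset.univ.filter fun x => tableauRow t x < k ∧ tableauCol t x = j).card := by
    have h1 := h k
    rw [card_filter_lt_eq_sum (t := t), card_filter_lt_eq_sum (t := t)] at h1
    exact (Finset.sum_eq_sum_iff_of_le fun j _ => card_col_le hf j k).1 h1 j hj
  have hmem (x : α) : (f x, tableauCol t x) ∈ μ := by
    rw [YoungDiagram.mem_iff_lt_colLen]
    set j := tableauCol t x with hj
    have h1 := hcol j (μ.colLen j) (by simp [hj])
    have h2 : (Finset.univ.filter fun x => tableauRow t x < μ.colLen j ∧ tableauCol t x = j) =
        Finset.univ.filter fun x => tableauCol t x = j := by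
      refine Finset.filter_congr fun y _ => and_iff_right_of_imp fun hy => ?_
      rw [← hy]
      exact YoungDiagram.mem_iff_lt_colLen.1 (tableau_mem t y)
    rw [h2] at h1
    have h3 : (Finset.univ.filter fun x => f x < μ.colLen j ∧ tableauCol t x = j) ⊆
        Finset.univ.filter fun x => tableauCol t x = j := fun y hy => by
      rw [Finset.mem_filter] at hy ⊢
      exact ⟨hy.1, hy.2.2⟩
    have h4 : x ∈ Finset.univ.filter fun x => tableauCol t x = j := by simp [hj]
    rw [← Finset.eq_of_subset_of_card_le h3 h1.ge, Finset.mem_filter] at h4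
    exact h4.2.1
  choose s hsr hsc using fun x => exists_tableau_eq t (hmem x)
  have hinj : Function.Injective s := fun x y hxy => by
    by_contra hne
    refine hf x y hne ?_ ?_
    · exact (hsc x).symm.trans ((congrArg _ hxy).trans (hsc y))
    · exact (hsr x).symm.trans ((congrArg _ hxy).trans (hsr y))
  exact ⟨Equiv.ofBijective s (Finite.injective_iff_bijective.1 hinj), funext hsc,
    funext fun x => (hsr x).symm⟩

variable (t)

theorem card_row_eq (i : ℕ) :
    (Finset.univ.filter fun x => tableauRow t x = i).card = μ.rowLen i := by
  rw [← Finset.card_range (μ.rowLen i)]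
  refine Finset.card_bij (fun x _ => tableauCol t x) ?_ ?_ ?_
  · intro x hx
    rw [Finset.mem_range, ← YoungDiagram.mem_iff_lt_rowLen, ← (Finset.mem_filter.1 hx).2]
    exact tableau_mem t x
  · intro x hx y hy hxy
    rw [Finset.mem_filter] at hx hy
    exact tableau_ext t (hx.2.trans hy.2.symm) hxy
  · intro j hj
    rw [Finset.mem_range, ← YoungDiagram.mem_iff_lt_rowLen] at hj
    obtain ⟨x, hx, hxj⟩ := exists_tableau_eq t hj
    exact ⟨x, by simp [hx], hxj⟩

theorem eq_of_card_filter_lt_eq {ν : YoungDiagram} (s : α ≃ ν.cells)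
    (h : ∀ k, (Finset.univ.filter fun x => tableauRow t x < k).card =
      (Finset.univ.filter fun x => tableauRow s x < k).card) : μ = ν := by
  have key (g : α → ℕ) (k : ℕ) : (Finset.univ.filter fun x => g x < k + 1).card =
      (Finset.univ.filter fun x => g x < k).card + (Finset.univ.filter fun x => g x = k).card := by
    classical
    rw [← Finset.card_union_of_disjoint, ← Finset.filter_or]
    · congr 1
      exact Finset.filter_congr fun x _ => Nat.lt_succ_iff_lt_or_eq
    · exact Finset.disjoint_filter.2 fun x _ h1 h2 => by omega
  have hrow (i : ℕ) : μ.rowLen i = ν.rowLen i := by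
    rw [← card_row_eq t, ← card_row_eq s]
    have h1 := h (i + 1)
    rw [key, key, h i] at h1
    omega
  ext ⟨i, j⟩
  rw [YoungDiagram.mem_cells, YoungDiagram.mem_cells, YoungDiagram.mem_iff_lt_rowLen,
    YoungDiagram.mem_iff_lt_rowLen, hrow]

end Tableau

/-! ### Polytabloids and simple quotients of Specht modules -/

section Polytabloids

open MonoidAlgebra (of)
open Equiv (Perm)

/-- If `σ` preserves `c`, `τ` preserves `d`, and both have the same effect on `c + d`, then they
preserve `c + d`. -/
theorem add_comp_eq_of_comp_eq {α : Type v} [Fintype α] {c d : α → ℕ} {σ τ : Perm α}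
    (hσ : c ∘ σ = c) (hτ : d ∘ τ = d) (h : (c + d) ∘ σ = (c + d) ∘ τ) : (c + d) ∘ σ = c + d := by
  have hσ' (x : α) : (c (σ x) : ℤ) = c x := by exact_mod_cast congrFun hσ x
  have hτ' (x : α) : (d (τ x) : ℤ) = d x := by exact_mod_cast congrFun hτ x
  have h' (x : α) : (c (σ x) + d (σ x) : ℤ) = c (τ x) + d (τ x) := by exact_mod_cast congrFun h x
  have hsum (g : α → ℤ) (ρ : Perm α) : ∑ x, g (ρ x) = ∑ x, g x := Equiv.sum_comp ρ g
  -- With `s = c + d`, the cross term `s (σ x) * s x` equals `s (σ x) * c (σ x) + s (τ x) * d (τ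
  -- x)`. By reindexing it sums to `∑ s ^ 2`, so the squares sum to zero.
  have key : ∑ x, ((c (σ x) + d (σ x) : ℤ) - (c x + d x)) ^ 2 = 0 := by
    have e1 := hsum (fun x => (c x + d x : ℤ) ^ 2) σ
    have e2 := hsum (fun x => (c x + d x : ℤ) * c x) σ
    have e3 := hsum (fun x => (c x + d x : ℤ) * d x) τ
    have e4 (x : α) : ((c (σ x) + d (σ x) : ℤ) - (c x + d x)) ^ 2 =
        (c (σ x) + d (σ x)) ^ 2 - 2 * ((c (σ x) + d (σ x)) * c (σ x)) -
          2 * ((c (τ x) + d (τ x)) * d (τ x)) + (c x + d x) ^ 2 := by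
      rw [← h', hτ', hσ']; ring
    have e5 : ∑ x, (c x + d x : ℤ) ^ 2 = ∑ x, (c x + d x : ℤ) * c x + ∑ x, (c x + d x : ℤ) * d x := by
      rw [← Finset.sum_add_distrib]
      exact Finset.sum_congr rfl fun x _ => by ring
    simp_rw [e4]
    rw [Finset.sum_add_distrib, Finset.sum_sub_distrib, Finset.sum_sub_distrib, ← Finset.mul_sum,
      ← Finset.mul_sum, e1, e2, e3, e5]
    ring
  funext x
  have := (Finset.sum_eq_zero_iff_of_nonneg fun x _ => sq_nonneg _).1 key x (Finset.mem_univ x)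
  have h2 := sub_eq_zero.1 (pow_eq_zero_iff (two_ne_zero)|>.1 this)
  change c (σ x) + d (σ x) = c x + d x
  exact_mod_cast h2

section Polytabloid

variable (K : Type u) [Field K] {α : Type v} {μ : YoungDiagram} (t : α ≃ μ.cells)

/-- The alternating sum of the column permutations of a tabloid. -/
noncomputable def polytabloid [Fintype α] [DecidableEq α] : (α → ℕ) →₀ K :=
  permRep K (antisymmetrizer K (tableauCol t)) (Finsupp.single (tableauRow t) 1)

/-- The permutation module of the tabloids with the shape of `t`. -/
noncomputable def tabloidSpan : Submodule K ((α → ℕ) →₀ K) :=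
  Submodule.span K (Set.range fun σ : Perm α => Finsupp.single (tableauRow t ∘ σ) 1)

variable {K t}

theorem permRep_mem_tabloidSpan (x : MonoidAlgebra K (Perm α)) {w : (α → ℕ) →₀ K}
    (hw : w ∈ tabloidSpan K t) : permRep K x w ∈ tabloidSpan K t := by
  induction x using MonoidAlgebra.induction_on with
  | of σ =>
    induction hw using Submodule.span_induction with
    | mem w hw =>
      obtain ⟨τ, rfl⟩ := hw
      rw [permRep_of_single, Function.comp_assoc, ← Perm.coe_mul]
      exact Submodule.subset_span ⟨_, rfl⟩
    | zero => rw [map_zero]; exact zero_mem _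
    | add v w _ _ hv hw => rw [map_add]; exact add_mem hv hw
    | smul a w _ hw => rw [map_smul]; exact Submodule.smul_mem _ _ hw
  | add x y hx hy => rw [map_add]; exact add_mem hx hy
  | smul a x hx => rw [map_smul]; exact Submodule.smul_mem _ _ hx

theorem perm_eq_of_comp_eq {σ τ : Perm α} (hr : tableauRow t ∘ σ = tableauRow t ∘ τ)
    (hc : tableauCol t ∘ σ = tableauCol t ∘ τ) : σ = τ :=
  Equiv.ext fun x => tableau_ext t (congrFun hr x) (congrFun hc x)

/-- There is a permutation that reverses all rows of a tableau. -/
theorem exists_rowReversal (t : α ≃ μ.cells) : ∃ ρ : Perm α, ρ * ρ = 1 ∧ tableauRow t ∘ ρ = tableauRow t ∧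
    ∀ x, tableauCol t x + (tableauCol t (ρ x) + 1) = μ.rowLen (tableauRow t x) := by
  have hlt (x : α) : tableauCol t x < μ.rowLen (tableauRow t x) :=
    YoungDiagram.mem_iff_lt_rowLen.1 (tableau_mem t x)
  have h (x : α) : ∃ y, tableauRow t y = tableauRow t x ∧
      tableauCol t y = μ.rowLen (tableauRow t x) - 1 - tableauCol t x := by
    refine exists_tableau_eq t (YoungDiagram.mem_iff_lt_rowLen.2 ?_)
    have := hlt x
    omega
  choose ρ hρr hρc using h
  have hinv (x : α) : ρ (ρ x) = x := by
    refine tableau_ext t (by rw [hρr, hρr]) ?_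
    rw [hρc, hρr, hρc]
    have := hlt x
    omega
  refine ⟨⟨ρ, ρ, hinv, hinv⟩, Equiv.ext hinv, funext hρr, fun x => ?_⟩
  have := hlt x
  have := hρc x
  change tableauCol t x + (tableauCol t (ρ x) + 1) = _
  omega

variable [Fintype α]

theorem card_filter_comp_lt (g : α → ℕ) (σ : Perm α) (k : ℕ) :
    (Finset.univ.filter fun x => (g ∘ σ) x < k).card = (Finset.univ.filter fun x => g x < k).card := by
  refine Finset.card_bij (fun x _ => σ x) ?_ ?_ ?_
  · simp
  · simp
  · intro y hy
    exact ⟨σ⁻¹ y, by simpa using hy, by simp⟩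

variable [DecidableEq α]

theorem polytabloid_mem : polytabloid K t ∈ tabloidSpan K t :=
  permRep_mem_tabloidSpan _ (Submodule.subset_span ⟨1, rfl⟩)

/-- Some tabloid of shape `ν` survives antisymmetrization, so it separates the entries of each
column of `t`, and dominance follows. -/
theorem card_filter_lt_le_of_permRep_ne_zero {ν : YoungDiagram} {s : α ≃ ν.cells}
    {w : (α → ℕ) →₀ K} (hw : w ∈ tabloidSpan K s)
    (h : permRep K (antisymmetrizer K (tableauCol t)) w ≠ 0) (k : ℕ) :
    (Finset.univ.filter fun x => tableauRow s x < k).card ≤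
      (Finset.univ.filter fun x => tableauRow t x < k).card := by
  have : ∃ σ : Perm α, permRep K (antisymmetrizer K (tableauCol t))
      (Finsupp.single (tableauRow s ∘ σ) 1) ≠ 0 := by
    by_contra! h0
    refine h ?_
    induction hw using Submodule.span_induction with
    | mem w hw => obtain ⟨τ, rfl⟩ := hw; exact h0 τ
    | zero => rw [map_zero]
    | add v w _ _ hv hw =>
      by_contra h1
      rw [map_add] at h1
      by_cases h2 : permRep K (antisymmetrizer K (tableauCol t)) v = 0
      · refine h1 ?_
        rw [h2, zero_add]
        by_contra h3
        exact h3 (hw h3)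
      · exact h2 (hv h2)
    | smul a w _ hw =>
      by_contra h1
      rw [map_smul] at h1
      by_cases h2 : permRep K (antisymmetrizer K (tableauCol t)) w = 0
      · exact h1 (by rw [h2, smul_zero])
      · exact h2 (hw h2)
  obtain ⟨σ, hσ⟩ := this
  rw [← card_filter_comp_lt _ σ]
  exact card_filter_lt_le (fun x y hxy hc => ne_of_permRep_antisymmetrizer_ne_zero K hσ hxy hc) k

/-- A surviving tabloid of the shape of `t` differs from that of `t` by a column permutation, which
contributes only a sign. -/
theorem permRep_antisymmetrizer_mem {w : (α → ℕ) →₀ K} (hw : w ∈ tabloidSpan K t) :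
    ∃ a : K, permRep K (antisymmetrizer K (tableauCol t)) w = a • polytabloid K t := by
  induction hw using Submodule.span_induction with
  | mem w hw =>
    obtain ⟨τ, rfl⟩ := hw
    by_cases h : permRep K (antisymmetrizer K (tableauCol t))
      (Finsupp.single (tableauRow t ∘ τ) 1) = 0
    · exact ⟨0, by simpa using h⟩
    · obtain ⟨σ, hσ, hf⟩ := exists_perm_of_card_eq
        (fun x y hxy hc => ne_of_permRep_antisymmetrizer_ne_zero K h hxy hc)
        (card_filter_comp_lt (tableauRow t) τ)
      simp only [hf]
      exact ⟨_, permRep_antisymmetrizer_comp K _ hσ⟩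
  | zero => exact ⟨0, by simp⟩
  | add v w _ _ hv hw =>
    obtain ⟨a, ha⟩ := hv
    obtain ⟨b, hb⟩ := hw
    exact ⟨a + b, by rw [map_add, ha, hb, add_smul]⟩
  | smul c w _ hw =>
    obtain ⟨a, ha⟩ := hw
    exact ⟨c * a, by rw [map_smul, ha, mul_smul]⟩

theorem permRep_antisymmetrizer_single_row (f : α → ℕ) :
    permRep K (antisymmetrizer K (tableauCol t)) (Finsupp.single f 1) (tableauRow t) =
      ∑ σ ∈ levelStabilizer (tableauCol t),
        if f = tableauRow t ∘ σ then ((Perm.sign σ : ℤ) : K) else 0 := by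
  rw [permRep_antisymmetrizer, Finsupp.finsetSum_apply]
  refine Finset.sum_congr rfl fun σ _ => ?_
  rw [Finsupp.single_apply]
  congr 1
  rw [eq_iff_iff]
  constructor
  · intro h
    rw [← h, Function.comp_assoc, ← Perm.coe_mul, inv_mul_cancel, Perm.coe_one, Function.comp_id]
  · rintro rfl
    rw [Function.comp_assoc, ← Perm.coe_mul, mul_inv_cancel, Perm.coe_one, Function.comp_id]

theorem polytabloid_row : polytabloid K t (tableauRow t) = 1 := by
  rw [polytabloid, permRep_antisymmetrizer_single_row, Finset.sum_eq_single 1]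
  · simp
  · intro σ hσ h1
    refine if_neg fun h2 => h1 ?_
    exact perm_eq_of_comp_eq (t := t) h2.symm (mem_levelStabilizer.1 hσ)
  · intro h
    exact absurd (mem_levelStabilizer.2 rfl) h

theorem polytabloid_ne_zero : polytabloid K t ≠ 0 := fun h => by
  have := polytabloid_row (K := K) (t := t)
  rw [h] at this
  exact zero_ne_one this

variable (t)

/-- The column permutations that preserve the lengths of rows. -/
def rowLenStabilizer : Finset (Perm α) :=
  (levelStabilizer (tableauCol t)).filter fun σ =>
    (μ.rowLen ∘ tableauRow t) ∘ σ = μ.rowLen ∘ tableauRow t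

/-- Take `x` to be the row reversal `ρ`. The result is a multiple of the polytabloid, and the scalar
is the coefficient at `tableauRow t`. Contributing pairs of column permutations are exactly those
with `σ` preserving row lengths and `τ = ρ * σ⁻¹ * ρ`; their signs multiply to one. -/
theorem exists_antisymmetrizer_eigen :
    ∃ x : MonoidAlgebra K (Perm α), permRep K (antisymmetrizer K (tableauCol t) * x)
      (polytabloid K t) = ((rowLenStabilizer t).card : K) • polytabloid K t := by
  obtain ⟨ρ, hρ, hρr, hρc⟩ := exists_rowReversal t
  have hρi : ρ⁻¹ = ρ := inv_eq_of_mul_eq_one_left hρ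
  refine ⟨of K _ ρ, ?_⟩
  rw [map_mul, Module.End.mul_apply]
  obtain ⟨a, ha⟩ := permRep_antisymmetrizer_mem
    (permRep_mem_tabloidSpan (of K _ ρ) (polytabloid_mem (K := K) (t := t)))
  rw [ha]
  congr 1
  have h1 := DFunLike.congr_fun ha (tableauRow t)
  rw [Finsupp.smul_apply, polytabloid_row, smul_eq_mul, mul_one] at h1
  rw [← h1, polytabloid, permRep_antisymmetrizer, map_sum, map_sum, Finsupp.finsetSum_apply]
  set C := levelStabilizer (tableauCol t) with hC
  set L := μ.rowLen ∘ tableauRow t with hL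
  have key (σ : Perm α) (hσ : σ ∈ C) (τ : Perm α) (hτ : τ ∈ C) :
      (tableauRow t ∘ ⇑τ⁻¹) ∘ ⇑ρ⁻¹ = tableauRow t ∘ σ ↔ L ∘ σ = L ∧ τ = ρ * σ⁻¹ * ρ := by
    rw [hC, mem_levelStabilizer] at hσ hτ
    have hρρ (x : α) : ρ (ρ x) = x := Equiv.congr_fun hρ x
    have hr (x : α) : tableauRow t (ρ x) = tableauRow t x := congrFun hρr x
    have hc (x : α) : tableauCol t (τ⁻¹ x) = tableauCol t x := by
      simpa using (congrFun hτ (τ⁻¹ x)).symm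
    rw [hρi]
    constructor
    · intro h
      set τ' : Perm α := ρ * τ⁻¹ * ρ with hτ'
      -- Column plus reversed column plus one is the row length, so `add_comp_eq_of_comp_eq` applies
      -- to `σ` and `τ'`.
      let d : α → ℕ := fun x => tableauCol t (ρ x) + 1
      have hL : tableauCol t + d = L := funext hρc
      have hrow : tableauRow t ∘ σ = tableauRow t ∘ τ' := by
        rw [← h]
        funext x
        exact (hr _).symm
      have hd : d ∘ τ' = d := by
        funext x
        simp only [d, τ', Function.comp_apply, Perm.mul_apply, hρρ, hc]
      have hLσ := add_comp_eq_of_comp_eq hσ hd (by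
        rw [hL]
        exact congrArg (μ.rowLen ∘ ·) hrow)
      rw [hL] at hLσ
      refine ⟨hLσ, ?_⟩
      have hστ : ρ * σ = ρ * τ' := by
        refine perm_eq_of_comp_eq (t := t) ?_ ?_
        · funext x
          exact (hr _).trans ((congrFun hrow x).trans (hr _).symm)
        · funext x
          have h1 := congrFun hLσ x
          have h2 := congrFun hσ x
          have h3 := congrFun hd x
          rw [← hL] at h1
          simp only [Function.comp_apply, Pi.add_apply, d, Perm.mul_apply] at h1 h2 h3 ⊢
          omega
      rw [mul_left_cancel hστ, hτ', mul_inv_rev, mul_inv_rev, inv_inv, hρi, ← mul_assoc, ← mul_assoc,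
        hρ, one_mul, mul_assoc, hρ, mul_one]
    · rintro ⟨-, rfl⟩
      funext x
      simp [hρi, hr, hρρ]
  have hsum : ∀ τ ∈ C, (permRep K (antisymmetrizer K (tableauCol t)) (permRep K (of K _ ρ)
      (Finsupp.single (tableauRow t ∘ ⇑τ⁻¹) ((Perm.sign τ : ℤ) : K)))) (tableauRow t) =
      ∑ σ ∈ C, if L ∘ σ = L ∧ τ = ρ * σ⁻¹ * ρ then
        ((Perm.sign τ : ℤ) : K) * ((Perm.sign σ : ℤ) : K) else 0 := by
    intro τ hτ
    rw [permRep_of_single, ← mul_one ((Perm.sign τ : ℤ) : K), ← smul_eq_mul, ← Finsupp.smul_single,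
      map_smul, Finsupp.smul_apply, permRep_antisymmetrizer_single_row, Finset.smul_sum]
    refine Finset.sum_congr rfl fun σ hσ => ?_
    simp only [key σ hσ τ hτ, smul_eq_mul, mul_one, mul_ite, mul_zero]
  rw [Finset.sum_congr rfl hsum, Finset.sum_comm, rowLenStabilizer, Finset.card_filter, Nat.cast_sum]
  refine Finset.sum_congr rfl fun σ hσ => ?_
  by_cases hLσ : L ∘ σ = L
  · have hmem : ρ * σ⁻¹ * ρ ∈ C := by
      rw [mem_levelStabilizer] at hσ
      rw [hC, mem_levelStabilizer]
      funext x
      have h2 := hρc (σ⁻¹ (ρ x))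
      have h3 := hρc (ρ x)
      have h4 : L (σ⁻¹ (ρ x)) = L (ρ x) := by simpa using (congrFun hLσ (σ⁻¹ (ρ x))).symm
      have h5 : tableauCol t (σ⁻¹ (ρ x)) = tableauCol t (ρ x) := by
        simpa using (congrFun hσ (σ⁻¹ (ρ x))).symm
      have h6 : ρ (ρ x) = x := Equiv.congr_fun hρ x
      rw [h6] at h3
      simp only [hL, Function.comp_apply, Perm.mul_apply] at h4 ⊢
      omega
    rw [Finset.sum_eq_single_of_mem _ hmem fun τ _ hτ => if_neg fun h => hτ h.2]
    rw [if_pos ⟨hLσ, rfl⟩, if_pos hLσ, Perm.sign_mul, Perm.sign_mul, Perm.sign_inv, mul_right_comm,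
      Int.units_mul_self, one_mul, ← Int.cast_mul, ← Units.val_mul, Int.units_mul_self]
    simp
  · rw [if_neg hLσ]
    simp [hLσ]

theorem cast_factorial_ne_zero {k : ℕ} (h : ringChar K ≠ 0 → k < ringChar K) :
    (k.factorial : K) ≠ 0 := by
  rw [Ne, CharP.cast_eq_zero_iff K (ringChar K)]
  intro hdvd
  rcases CharP.char_is_prime_or_zero K (ringChar K) with hp | hp
  · exact absurd (h hp.ne_zero) (hp.dvd_factorial.1 hdvd).not_gt
  · rw [hp, zero_dvd_iff] at hdvd
    exact k.factorial_ne_zero hdvd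

/-- The stabilizer is a product of symmetric groups, one for each column and row length `L`. Rows of
length `L` number `colLen (L - 1) - colLen L`, less than a positive characteristic, so the
factorials are nonzero in `K`. -/
theorem rowLenStabilizer_card_ne_zero (h : ∀ j, ringChar K ≠ 0 →
    μ.colLen j - μ.colLen (j + 1) < ringChar K) : ((rowLenStabilizer t).card : K) ≠ 0 := by
  let F : α → ℕ × ℕ := fun x => (tableauCol t x, μ.rowLen (tableauRow t x))
  have hcard : (rowLenStabilizer t).card = Fintype.card {σ : Perm α // F ∘ σ = F} := by
    rw [Fintype.card_subtype, rowLenStabilizer, levelStabilizer, Finset.filter_filter]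
    congr 1
    refine Finset.filter_congr fun σ _ => ?_
    simp only [funext_iff, Function.comp_apply, F, Prod.mk.injEq, forall_and]
  rw [hcard, DomMulAct.stabilizer_card', Nat.cast_prod, Finset.prod_ne_zero_iff]
  intro p hp
  obtain ⟨x, -, rfl⟩ := Finset.mem_image.1 hp
  set L := μ.rowLen (tableauRow t x) with hL
  have hLpos : 0 < L :=
    (Nat.zero_le _).trans_lt (YoungDiagram.mem_iff_lt_rowLen.1 (tableau_mem t x))
  refine cast_factorial_ne_zero fun h0 => lt_of_le_of_lt ?_ (h (L - 1) h0)
  rw [Nat.sub_add_cancel hLpos, Fintype.card_subtype, ← Nat.card_Ico]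
  refine Finset.card_le_card_of_injOn (tableauRow t) (fun y hy => ?_) fun y hy z hz hyz => ?_
  · simp only [Finset.coe_filter, Finset.mem_univ, true_and, Set.mem_ofPred_eq, F, Prod.mk.injEq] at hy
    rw [Finset.coe_Ico, Set.mem_Ico, ← YoungDiagram.mem_iff_lt_colLen, ← not_lt,
      ← YoungDiagram.mem_iff_lt_colLen, YoungDiagram.mem_iff_lt_rowLen,
      YoungDiagram.mem_iff_lt_rowLen]
    omega
  · simp only [Finset.coe_filter, Finset.mem_univ, true_and, Set.mem_ofPred_eq, F, Prod.mk.injEq]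
      at hy hz
    exact tableau_ext t hyz (hy.1.trans hz.1.symm)

variable (K) in
/-- The elements of the group algebra that annihilate the polytabloid. -/
noncomputable def polytabloidAnnihilator : Ideal (MonoidAlgebra K (Perm α)) where
  carrier := {x | permRep K x (polytabloid K t) = 0}
  zero_mem' := by simp
  add_mem' := fun {x y} hx hy => by
    change permRep K (x + y) _ = 0
    rw [map_add, LinearMap.add_apply, show permRep K x _ = 0 from hx,
      show permRep K y _ = 0 from hy, add_zero]
  smul_mem' := fun c x hx => by
    change permRep K (c * x) _ = 0
    rw [map_mul, Module.End.mul_apply, show permRep K x _ = 0 from hx, map_zero]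

/-- Modulo the annihilator, the antisymmetrizer times `x` is a nonzero scalar, so no proper left
ideal above the annihilator contains it. -/
theorem exists_maximal_of_tableau (h : ∀ j, ringChar K ≠ 0 →
    μ.colLen j - μ.colLen (j + 1) < ringChar K) :
    ∃ m : Ideal (MonoidAlgebra K (Perm α)), m.IsMaximal ∧ polytabloidAnnihilator K t ≤ m ∧
      ∃ x, antisymmetrizer K (tableauCol t) * x ∉ m := by
  have hne : polytabloidAnnihilator K t ≠ ⊤ := fun h1 => by
    have h2 : (1 : MonoidAlgebra K (Perm α)) ∈ polytabloidAnnihilator K t := h1 ▸ trivial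
    have h3 : permRep K 1 (polytabloid K t) = 0 := h2
    rw [map_one] at h3
    exact polytabloid_ne_zero h3
  obtain ⟨m, hm, hle⟩ := Ideal.exists_le_maximal _ hne
  refine ⟨m, hm, hle, ?_⟩
  obtain ⟨x, hx⟩ := exists_antisymmetrizer_eigen (K := K) t
  refine ⟨x, fun hxm => hm.ne_top ?_⟩
  set a : K := ((rowLenStabilizer t).card : K)
  have ha : a ≠ 0 := rowLenStabilizer_card_ne_zero t h
  have h1 : antisymmetrizer K (tableauCol t) * x - algebraMap K _ a ∈ polytabloidAnnihilator K t := by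
    change permRep K _ _ = 0
    rw [map_sub, LinearMap.sub_apply, hx, AlgHom.commutes, Module.algebraMap_end_apply, sub_self]
  have h2 := sub_mem hxm (hle h1)
  rw [sub_sub_cancel] at h2
  exact Ideal.eq_top_of_isUnit_mem _ h2 ((IsUnit.mk0 a ha).map _)

/-- The antisymmetrizer of `t` acts nontrivially on the first quotient, hence on the second, hence
on the Specht module of `s`. -/
theorem card_filter_lt_le_of_equiv {ν : YoungDiagram} (s : α ≃ ν.cells)
    {m m' : Ideal (MonoidAlgebra K (Perm α))} (hm' : polytabloidAnnihilator K s ≤ m')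
    (hm : ∃ x, antisymmetrizer K (tableauCol t) * x ∉ m)
    (e : (MonoidAlgebra K (Perm α) ⧸ m) ≃ₗ[MonoidAlgebra K (Perm α)]
      (MonoidAlgebra K (Perm α) ⧸ m')) (k : ℕ) :
    (Finset.univ.filter fun x => tableauRow s x < k).card ≤
      (Finset.univ.filter fun x => tableauRow t x < k).card := by
  obtain ⟨x, hx⟩ := hm
  obtain ⟨y, hy⟩ := m'.mkQ_surjective (e (m.mkQ x))
  have h1 : antisymmetrizer K (tableauCol t) * y ∉ m' := fun h => hx <| by
    rw [← smul_eq_mul, ← Submodule.Quotient.mk_eq_zero] at h ⊢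
    rw [Submodule.Quotient.mk_smul] at h ⊢
    rw [← Submodule.mkQ_apply, hy, ← map_smul, e.map_eq_zero_iff] at h
    exact h
  have h2 : permRep K (antisymmetrizer K (tableauCol t) * y) (polytabloid K s) ≠ 0 :=
    fun h => h1 (hm' h)
  rw [map_mul, Module.End.mul_apply] at h2
  exact card_filter_lt_le_of_permRep_ne_zero (permRep_mem_tabloidSpan y polytabloid_mem) h2 k

end Polytabloid

/-- The shape of a tableau is determined by the simple module. -/
theorem eq_of_tableau_equiv {K : Type u} [Field K] {α : Type v} [Fintype α] [DecidableEq α]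
    {μ ν : YoungDiagram} (t : α ≃ μ.cells) (s : α ≃ ν.cells)
    {m m' : Ideal (MonoidAlgebra K (Perm α))}
    (hm : polytabloidAnnihilator K t ≤ m ∧ ∃ x, antisymmetrizer K (tableauCol t) * x ∉ m)
    (hm' : polytabloidAnnihilator K s ≤ m' ∧ ∃ x, antisymmetrizer K (tableauCol s) * x ∉ m')
    (e : (MonoidAlgebra K (Perm α) ⧸ m) ≃ₗ[MonoidAlgebra K (Perm α)]
      (MonoidAlgebra K (Perm α) ⧸ m')) : μ = ν :=
  eq_of_card_filter_lt_eq t s fun k => le_antisymm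
    (card_filter_lt_le_of_equiv s t hm.1 hm'.2 e.symm k)
    (card_filter_lt_le_of_equiv t s hm'.1 hm.2 e k)

end Polytabloids

/-! ### Conjugacy classes of `p`-regular permutations -/

section Classes

open Equiv (Perm)

/-- Write the order as `p ^ a * b` with `p ∤ b` and choose `m ≡ 0` modulo `p ^ a` and `m ≡ 1` modulo
`b`. -/
theorem exists_pow_regular {G : Type w} [Group G] [Finite G] {p : ℕ} (hp : p.Prime) (g : G) :
    ∃ m k : ℕ, ¬ p ∣ orderOf (g ^ m) ∧ g ^ p ^ k = (g ^ m) ^ p ^ k := by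
  obtain ⟨a, b, hb, hab⟩ := Nat.exists_eq_pow_mul_and_not_dvd (orderOf_pos g).ne' p hp.ne_one
  have hcop : (p ^ a).Coprime b := Nat.Coprime.pow_left a ((hp.coprime_iff_not_dvd).2 hb)
  obtain ⟨m, hm0, hm1⟩ := Nat.chineseRemainder hcop 0 1
  refine ⟨m, a, fun h => hb (h.trans (orderOf_dvd_of_pow_eq_one ?_)), ?_⟩
  · rw [← pow_mul, ← orderOf_dvd_iff_pow_eq_one, hab]
    exact mul_dvd_mul_right ((Nat.modEq_zero_iff_dvd).1 hm0) b
  · rw [← pow_mul, pow_eq_pow_iff_modEq, hab, mul_comm m]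
    simpa using (hm1.mul_left' (p ^ a)).symm

theorem exists_perm_of_partition {l : ℕ} (π : l.Partition) :
    ∃ σ : Perm (Fin l), σ.cycleType = π.parts.filter (2 ≤ ·) := by
  rw [Perm.exists_with_cycleType_iff]
  refine ⟨?_, fun a ha => (Multiset.mem_filter.1 ha).2⟩
  have h := Multiset.filter_le (2 ≤ ·) π.parts
  obtain ⟨t, ht⟩ := Multiset.le_iff_exists_add.1 h
  have := congrArg Multiset.sum ht
  rw [Multiset.sum_add, π.parts_sum] at this
  rw [Fintype.card_fin]
  omega

/-- Replace `g` by its `p`-regular part, whose cycle lengths are prime to `p`. For `p = 0` the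
condition on parts is void and all classes occur. -/
theorem exists_representatives (l p : ℕ) (hp : p.Prime ∨ p = 0) :
    ∃ s : Nat.Partition.restricted l (¬ p ∣ ·) → Perm (Fin l), ∀ g, ∃ r, TraceEquivalent p g (s r) := by
  choose s hs using fun π : l.Partition => exists_perm_of_partition π
  refine ⟨fun r => s r.1, fun g => ?_⟩
  have key : ∃ t : Perm (Fin l), (∀ i ∈ t.cycleType, ¬ p ∣ i) ∧ Commute g t ∧
      (g = t ∨ p.Prime ∧ ∃ k, g ^ p ^ k = t ^ p ^ k) := by
    rcases hp with hp | rfl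
    · obtain ⟨m, k, hm, hk⟩ := exists_pow_regular hp g
      exact ⟨g ^ m, fun i hi h => hm (h.trans (Perm.dvd_of_mem_cycleType hi)), Commute.self_pow g m,
        Or.inr ⟨hp, k, hk⟩⟩
    · refine ⟨g, fun i hi h => ?_, Commute.refl g, Or.inl rfl⟩
      have := Perm.two_le_of_mem_cycleType hi
      rw [zero_dvd_iff] at h
      omega
  obtain ⟨t, ht, hc, h⟩ := key
  let π : l.Partition :=
    ⟨t.partition.parts, t.partition.parts_pos, by rw [t.partition.parts_sum, Fintype.card_fin]⟩
  have hπ : π ∈ Nat.Partition.restricted l (¬ p ∣ ·) := by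
    rw [Nat.Partition.restricted, Finset.mem_filter]
    refine ⟨Finset.mem_univ _, fun i hi => ?_⟩
    change i ∈ t.partition.parts at hi
    rw [Perm.parts_partition, Multiset.mem_add] at hi
    rcases hi with hi | hi
    · exact ht i hi
    · rw [Multiset.eq_of_mem_replicate hi]
      rcases hp with hp | rfl
      · exact hp.not_dvd_one
      · simp
  refine ⟨⟨π, hπ⟩, t, ?_, hc, h⟩
  rw [Perm.isConj_iff_cycleType_eq, hs, ← Perm.filter_parts_partition_eq_cycleType]

end Classes

/-! ### Restricted diagrams and Glaisher's theorem -/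

section Diagrams

namespace YoungDiagram

variable (μ : YoungDiagram)

theorem rowLens_coe :
    (μ.rowLens : Multiset ℕ) = (Multiset.range (μ.colLen 0)).map μ.rowLen := rfl

theorem sum_rowLens : (μ.rowLens : Multiset ℕ).sum = μ.card := by
  rw [rowLens_coe, YoungDiagram.card, Finset.card_eq_sum_card_fiberwise (f := Prod.fst)
    (t := Finset.range (μ.colLen 0))]
  · change ∑ i ∈ Finset.range (μ.colLen 0), μ.rowLen i = _
    refine Finset.sum_congr rfl fun i _ => ?_
    rw [rowLen_eq_card]
    rfl
  · rintro ⟨i, j⟩ h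
    rw [Finset.mem_coe, Finset.mem_range, ← mem_iff_lt_colLen]
    exact μ.up_left_mem le_rfl (Nat.zero_le j) h

/-- The rows of length `i + 1` are those from `colLen (i + 1)` up to, but excluding, `colLen i`.
This turns restrictedness into a bound on multiplicities of parts. -/
theorem count_rowLens (i : ℕ) :
    (μ.rowLens : Multiset ℕ).count (i + 1) = μ.colLen i - μ.colLen (i + 1) := by
  rw [rowLens_coe, Multiset.count_map, ← Nat.card_Ico]
  change ((Finset.range (μ.colLen 0)).filter fun k => i + 1 = μ.rowLen k).card = _
  congr 1
  ext k
  have h1 := μ.mem_iff_lt_rowLen (i := k) (j := i)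
  have h2 := μ.mem_iff_lt_rowLen (i := k) (j := i + 1)
  rw [mem_iff_lt_colLen] at h1 h2
  have h3 := μ.colLen_anti 0 i (Nat.zero_le i)
  simp only [Finset.mem_filter, Finset.mem_range, Finset.mem_Ico]
  omega

/-- The partition given by the lengths of the rows. -/
def toPartition {l : ℕ} (h : μ.card = l) : l.Partition where
  parts := μ.rowLens
  parts_pos := μ.pos_of_mem_rowLens _
  parts_sum := μ.sum_rowLens.trans h

theorem eq_of_toPartition_eq {μ ν : YoungDiagram} {l : ℕ} {hμ : μ.card = l} {hν : ν.card = l}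
    (h : μ.toPartition hμ = ν.toPartition hν) : μ = ν := by
  have h1 : (μ.rowLens : Multiset ℕ) = ν.rowLens := congrArg (fun π => π.parts) h
  have h2 : μ.rowLens = ν.rowLens :=
    (Multiset.coe_eq_coe.1 h1).eq_of_pairwise' μ.rowLens_sorted.pairwise ν.rowLens_sorted.pairwise
  exact equivListRowLens.injective (Subtype.ext h2)

end YoungDiagram

theorem exists_diagram_of_partition {l : ℕ} (π : l.Partition) :
    ∃ (μ : YoungDiagram) (h : μ.card = l), μ.toPartition h = π := by
  let w := π.parts.sort (· ≥ ·)
  have hw : w.SortedGE := (Multiset.pairwise_sort _ _).sortedGE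
  have hpos : ∀ x ∈ w, 0 < x := fun x hx => π.parts_pos (by simpa [w] using hx)
  have hrow : ((YoungDiagram.ofRowLens w hw).rowLens : Multiset ℕ) = π.parts := by
    rw [YoungDiagram.rowLens_ofRowLens_eq_self hpos]
    exact Multiset.sort_eq _ _
  have hcard : (YoungDiagram.ofRowLens w hw).card = l := by
    rw [← YoungDiagram.sum_rowLens, hrow, π.parts_sum]
  exact ⟨_, hcard, Nat.Partition.ext hrow⟩

theorem YoungDiagram.forall_count_lt_iff (μ : YoungDiagram) {q : ℕ∞} (hq : 0 < q) :
    (∀ i ∈ (μ.rowLens : Multiset ℕ), ((μ.rowLens : Multiset ℕ).count i : ℕ∞) < q) ↔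
      ∀ j : ℕ, ((μ.colLen j - μ.colLen (j + 1) : ℕ) : ℕ∞) < q := by
  constructor
  · intro h j
    rw [← YoungDiagram.count_rowLens]
    by_cases hj : j + 1 ∈ (μ.rowLens : Multiset ℕ)
    · exact h _ hj
    -- A length that does not occur has multiplicity zero, which is where positivity of `q` enters.
    · rwa [Multiset.count_eq_zero_of_notMem hj, Nat.cast_zero]
  · intro h i hi
    obtain ⟨j, rfl⟩ := Nat.exists_eq_succ_of_ne_zero (μ.pos_of_mem_rowLens i hi).ne'
    rw [Nat.succ_eq_add_one, YoungDiagram.count_rowLens]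
    exact h j

theorem card_restrictedDiagram_eq (l : ℕ) {q : ℕ∞} (hq : 0 < q) :
    Nat.card (RestrictedDiagram l q) =
      Nat.card {π : l.Partition // ∀ i ∈ π.parts, (π.parts.count i : ℕ∞) < q} := by
  let f : RestrictedDiagram l q → {π : l.Partition // ∀ i ∈ π.parts, (π.parts.count i : ℕ∞) < q} :=
    fun μ => ⟨μ.1.toPartition μ.2.1, (μ.1.forall_count_lt_iff hq).2 μ.2.2⟩
  refine Nat.card_congr (Equiv.ofBijective f ⟨fun μ ν h => ?_, fun π => ?_⟩)
  · exact Subtype.ext (YoungDiagram.eq_of_toPartition_eq (hμ := μ.2.1) (hν := ν.2.1)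
      (congrArg Subtype.val h))
  · obtain ⟨μ, hμ, h⟩ := exists_diagram_of_partition π.1
    have h1 : (μ.rowLens : Multiset ℕ) = π.1.parts := congrArg (fun π => π.parts) h
    refine ⟨⟨μ, hμ, (μ.forall_count_lt_iff hq).1 ?_⟩, Subtype.ext h⟩
    rw [h1]
    exact π.2

theorem extendedChar_pos (K : Type u) [Field K] : 0 < extendedChar K := by
  rw [extendedChar]
  split_ifs with h
  · exact ENat.top_pos
  · exact_mod_cast Nat.pos_of_ne_zero h

/-- By Glaisher's theorem, the `p`-restricted diagrams are as many as the `p`-regular classes of the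
symmetric group. -/
theorem card_restrictedDiagram (K : Type u) [Field K] (l : ℕ) :
    Nat.card (RestrictedDiagram l (extendedChar K)) =
      (Nat.Partition.restricted l (¬ ringChar K ∣ ·)).card := by
  rw [card_restrictedDiagram_eq l (extendedChar_pos K), extendedChar]
  split_ifs with h
  · rw [h, Nat.Partition.restricted, Nat.card_eq_fintype_card, Fintype.card_subtype]
    congr 1
    refine Finset.filter_congr fun π _ => ?_
    simp only [ENat.natCast_lt_top, implies_true, zero_dvd_iff, true_iff]
    exact fun i hi => (π.parts_pos hi).ne'
  · rw [Nat.Partition.card_restricted_eq_card_countRestricted l (Nat.pos_of_ne_zero h),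
      Nat.Partition.countRestricted, Nat.card_eq_fintype_card, Fintype.card_subtype]
    simp only [Nat.cast_lt]

theorem colLen_sub_lt_of_restricted {K : Type u} [Field K] {l : ℕ}
    (μ : RestrictedDiagram l (extendedChar K)) (j : ℕ) (h : ringChar K ≠ 0) :
    μ.1.colLen j - μ.1.colLen (j + 1) < ringChar K := by
  have h1 : extendedChar K = ringChar K := if_neg h
  exact_mod_cast (μ.2.2 j).trans_eq h1

instance (l : ℕ) (q : ℕ∞) : Finite (RestrictedDiagram l q) :=
  Finite.of_injective (fun μ : RestrictedDiagram l q => μ.1.toPartition μ.2.1)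
    fun _ _ h => Subtype.ext (YoungDiagram.eq_of_toPartition_eq h)

end Diagrams

/-! ### Assembling the counts -/

section Main

variable (K : Type u) [Field K] {n : ℕ}

/-- A filling of a diagram with `l` boxes. -/
noncomputable def tableauOfCard {μ : YoungDiagram} {l : ℕ} (h : μ.card = l) : Fin l ≃ μ.cells :=
  (Finset.equivFinOfCardEq h).symm

theorem card_simpleClasses_transformation (hn : 1 ≤ n) {l : ℕ} (hl : 1 ≤ l) (hln : l ≤ n) :
    Finite (SimpleClassesWithApex K (transformationCell n l)) ∧
      Nat.card (SimpleClassesWithApex K (transformationCell n l)) =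
        Nat.card (RestrictedDiagram l (extendedChar K)) := by
  have : Finite (TransformationMonoid n) := inferInstanceAs (Finite (Fin n → Fin n))
  have := Fintype.ofFinite (RestrictedDiagram l (extendedChar K))
  obtain ⟨s, hs⟩ := exists_representatives l (ringChar K) (CharP.char_is_prime_or_zero K _)
  choose m hm hm1 hm2 using fun μ : RestrictedDiagram l (extendedChar K) =>
    exists_maximal_of_tableau (K := K) (tableauOfCard μ.2.1) (colLen_sub_lt_of_restricted μ)
  have h := card_simpleClassesWithApex (isRank_throughStrands hn) (permCorner hl hln)
    (throughStrands_permTransformation hl hln 1) s hs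
    (by rw [Fintype.card_coe, ← card_restrictedDiagram, Nat.card_eq_fintype_card])
    (fun μ => ⟨m μ, hm μ⟩)
    (fun μ ν ⟨e⟩ => Subtype.ext (eq_of_tableau_equiv _ _ ⟨hm1 μ, hm2 μ⟩ ⟨hm1 ν, hm2 ν⟩ e))
  rwa [← Nat.card_eq_fintype_card] at h

theorem card_simpleClasses_planar (hn : 1 ≤ n) {l : ℕ} (hl : 1 ≤ l) (hln : l ≤ n) :
    Nat.card (SimpleClassesWithApex K (planarCell n l)) = 1 := by
  have : Finite (TransformationMonoid n) := inferInstanceAs (Finite (Fin n → Fin n))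
  obtain ⟨m, hm⟩ := Ideal.exists_maximal (MonoidAlgebra K Unit)
  exact (card_simpleClassesWithApex (isRank_throughStrands_planar hn) (planarCorner hl hln)
    (throughStrands_truncation hl hln) (R := Unit) id
    (fun g => ⟨(), (), IsConj.refl _, Commute.refl _, Or.inl rfl⟩) (D := Unit) le_rfl
    (fun _ => ⟨m, hm⟩) (fun _ _ _ => rfl)).2

theorem IsRank.exists_isApex_iff {K : Type u} [Field K] {X : Type} [Monoid X] {rk : X → ℕ} {n : ℕ}
    (h : IsRank rk n) {G : ℕ → Type} [∀ l, Group (G l)]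
    (C : ∀ l, 1 ≤ l → l ≤ n → GroupCorner X (G l) {x | rk x < l})
    (hC : ∀ l hl hln, rk ((C l hl hln).toFun 1) = l) (J : Set X) :
    (∃ M : ModuleCat.{u} (MonoidAlgebra K X), IsSimpleModule (MonoidAlgebra K X) M ∧
      IsApex K M J) ↔ ∃ l, 1 ≤ l ∧ l ≤ n ∧ J = {x | rk x = l} := by
  constructor
  · rintro ⟨M, -, hM⟩
    exact h.isJCell_iff.1 hM.1
  · rintro ⟨l, hl, hln, rfl⟩
    exact exists_isApex_of_groupCorner h (C l hl hln) (hC l hl hln)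

end Main

theorem mainTheorem8 (K : Type u) [Field K] (n : ℕ) (hn : 1 ≤ n) :
    -- the transformation monoid: the apexes are the cells with `n, …, 1` through strands
    ((∀ J : Set (TransformationMonoid n),
        (∃ M : ModuleCat.{u} (MonoidAlgebra K (TransformationMonoid n)),
          IsSimpleModule (MonoidAlgebra K (TransformationMonoid n)) M ∧ IsApex K M J) ↔
        ∃ l : ℕ, 1 ≤ l ∧ l ≤ n ∧ J = transformationCell n l) ∧
      -- they form a chain, `n` being the least and `1` the greatest
      (∀ l m : ℕ, 1 ≤ l → l ≤ n → 1 ≤ m → m ≤ n →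
        (JCellLE (transformationCell n l) (transformationCell n m) ↔ m ≤ l)) ∧
      -- every simple module has precisely one apex
      (∀ M : ModuleCat.{u} (MonoidAlgebra K (TransformationMonoid n)),
        IsSimpleModule (MonoidAlgebra K (TransformationMonoid n)) M →
          ∃! J : Set (TransformationMonoid n), IsApex K M J) ∧
      -- the number of simple modules, up to isomorphism, for each apex
      (∀ l : ℕ, 1 ≤ l → l ≤ n →
        Finite (SimpleClassesWithApex K (transformationCell n l)) ∧
          Nat.card (SimpleClassesWithApex K (transformationCell n l)) =
            Nat.card (RestrictedDiagram l (extendedChar K)))) ∧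
    -- the same for the planar transformation monoid
    ((∀ J : Set (PlanarTransformationMonoid n),
        (∃ M : ModuleCat.{u} (MonoidAlgebra K (PlanarTransformationMonoid n)),
          IsSimpleModule (MonoidAlgebra K (PlanarTransformationMonoid n)) M ∧ IsApex K M J) ↔
        ∃ l : ℕ, 1 ≤ l ∧ l ≤ n ∧ J = planarCell n l) ∧
      (∀ l m : ℕ, 1 ≤ l → l ≤ n → 1 ≤ m → m ≤ n →
        (JCellLE (planarCell n l) (planarCell n m) ↔ m ≤ l)) ∧
      (∀ M : ModuleCat.{u} (MonoidAlgebra K (PlanarTransformationMonoid n)),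
        IsSimpleModule (MonoidAlgebra K (PlanarTransformationMonoid n)) M →
          ∃! J : Set (PlanarTransformationMonoid n), IsApex K M J) ∧
      (∀ l : ℕ, 1 ≤ l → l ≤ n →
        Nat.card (SimpleClassesWithApex K (planarCell n l)) = 1)) := by
  refine ⟨⟨fun J => ?_, ?_, ?_, ?_⟩, fun J => ?_, ?_, ?_, ?_⟩
  · exact (isRank_throughStrands hn).exists_isApex_iff (fun l => permCorner)
      (fun l hl hln => throughStrands_permTransformation hl hln 1) J
  · exact fun l m hl hln hm hmn => (isRank_throughStrands hn).jCellLE_iff hl hln hm hmn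
  · intro M hM
    have := IsSimpleModule.nontrivial (MonoidAlgebra K (TransformationMonoid n)) M
    exact (isRank_throughStrands hn).existsUnique_isApex K M
  · exact fun l hl hln => card_simpleClasses_transformation K hn hl hln
  · exact (isRank_throughStrands_planar hn).exists_isApex_iff (fun l => planarCorner)
      (fun l hl hln => throughStrands_truncation hl hln) J
  · exact fun l m hl hln hm hmn => (isRank_throughStrands_planar hn).jCellLE_iff hl hln hm hmn
  · intro M hM
    have := IsSimpleModule.nontrivial (MonoidAlgebra K (PlanarTransformationMonoid n)) M
    exact (isRank_throughStrands_planar hn).existsUnique_isApex K M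
  · exact fun l hl hln => card_simpleClasses_planar K hn hl hln
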